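/- **Algebras.** An *action lattice* is an algebra $(A,\wedge,\vee,\cdot,\backslash,/,{}^*,0,1)$ such that $(A,\wedge,\vee)$ is a lattice with least element $0$, $(A,\cdot,1)$ is a monoid, $x\cdot y\le z\iff y\le x\backslash z\iff x\le z/y$, and $1\vee xx^*\le x^*$, $xy\le y\Rightarrow x^*y\le y$, $yx\le y\Rightarrow yx^*\le y$, for all $x,y,z \in A$. It is *$*$-continuous* if $a^*=\bigvee_{n\in\mathbb N}a^n$ for all $a\in A$. **Sequents and rules.** Formulas are the terms in this language over a countably infinite set of propositional variables; a sequent $\Gamma\Rightarrow\beta$ consists of a finite sequence $\Gamma$ of formulas and a formula $\beta$. An *analytic rule* is a schematic rule with finitely many (possibly no) premises $\Gamma,\Upsilon_i,\Delta\Rightarrow\beta$ $(i<n)$ and conclusion $\Gamma,\Upsilon,\Delta\Rightarrow\beta$, where $\Gamma,\Delta$ are sequence metavariables, $\beta$ is a formula metavariable, $\Upsilon$ is a finite sequence of sequence metavariables, all of $\Gamma,\Delta$ and the members of $\Upsilon$ are distinct, and each $\Upsilon_i$ is a finite sequence of metavariables occurring in $\Upsilon$ (repetitions allowed). Its *analytic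 quasiequation* is $$q_a(R):\quad t(\Upsilon_0)\le y\ \&\ \cdots\ \&\ t(\Upsilon_{n-1})\le y\implies t(\Upsilon)\le y,$$ where $t$ replaces distinct metavariables by distinct variables and forms their product (the empty product is $1$), and $y$ is the variable of $\beta$. For a set $\mathcal R$ of analytic rules put $Q_a(\mathcal R)=\{q_a(R)\mid R\in\mathcal R\}$. Both systems below have the identity axiom $a\Rightarrow a$ for propositional variables $a$, the rules in $\mathcal R$, and the following *principal rules* (premises before the bar, conclusion after it; $i\in\{0,1\}$): - $0$L: $\ \mid\ \Gamma,0,\Delta\Rightarrow\beta$; $1$L: $\Gamma,\Delta\Rightarrow\beta\ \mid\ \Gamma,1,\Delta\Rightarrow\beta$; $1$R: $\ \mid\ \Rightarrow1$; - $\wedge$L$_i$: $\Gamma,\alpha_i,\Delta\Rightarrow\beta\ \mid\ \Gamma,\alpha_0\wedge\alpha_1,\Delta\Rightarrow\beta$; $\wedge$R: $\Gamma\Rightarrow\alpha_0;\ \Gamma\Rightarrow\alpha_1\ \mid\ \Gamma\Rightarrow\alpha_0\wedge\alpha_1$; - $\vee$L: $\Gamma,\alpha_0,\Delta\Rightarrow\beta;\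 \Gamma,\alpha_1,\Delta\Rightarrow\beta\ \mid\ \Gamma,\alpha_0\vee\alpha_1,\Delta\Rightarrow\beta$; $\vee$R$_i$: $\Gamma\Rightarrow\alpha_i\ \mid\ \Gamma\Rightarrow\alpha_0\vee\alpha_1$; - $\cdot$L: $\Gamma,\alpha_0,\alpha_1,\Delta\Rightarrow\beta\ \mid\ \Gamma,\alpha_0\cdot\alpha_1,\Delta\Rightarrow\beta$; $\cdot$R: $\Gamma\Rightarrow\alpha_0;\ \Delta\Rightarrow\alpha_1\ \mid\ \Gamma,\Delta\Rightarrow\alpha_0\cdot\alpha_1$; - $\backslash$L: $\Delta\Rightarrow\alpha_0;\ \Gamma,\alpha_1,\Sigma\Rightarrow\beta\ \mid\ \Gamma,\Delta,\alpha_0\backslash\alpha_1,\Sigma\Rightarrow\beta$; $\backslash$R: $\alpha_0,\Gamma\Rightarrow\alpha_1\ \mid\ \Gamma\Rightarrow\alpha_0\backslash\alpha_1$; - $/$L: $\Delta\Rightarrow\alpha_0;\ \Gamma,\alpha_1,\Sigma\Rightarrow\beta\ \mid\ \Gamma,\alpha_1/\alpha_0,\Delta,\Sigma\Rightarrow\beta$;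 $/$R: $\Gamma,\alpha_0\Rightarrow\alpha_1\ \mid\ \Gamma\Rightarrow\alpha_1/\alpha_0$; - $*$R$_0$: $\ \mid\ \Rightarrow\alpha^*$; $*$R$_1$: $\Gamma\Rightarrow\alpha;\ \Delta\Rightarrow\alpha^*\ \mid\ \Gamma,\Delta\Rightarrow\alpha^*$. In each of these, and in the two left rules for $*$ below, the *principal* occurrence is the occurrence in the conclusion of the formula introduced by the rule ($0$, $1$, $\alpha_0\wedge\alpha_1$, $\alpha^*$, etc.). The *auxiliary* occurrences are the displayed occurrences in the premises of $\alpha_i$, $\alpha$, $\alpha^*$, i.e. all those outside the contexts $\Gamma,\Delta,\Sigma$ and $\beta$. Analytic rules have no principal or auxiliary occurrences. A *preproof* is a possibly non-wellfounded tree, each node of which carries a rule instance (given by an instantiation of the metavariables of the rule, or an identity axiom) whose premises are, in order, exactly the sequents concluded at its successors; in particular every leaf carries an instance of a rule without premises. A formula occurrence in a premise of a rule instance is an *immediate ancestor* of one in the conclusion if the first is auxiliary and the second principal, or both come from the same formula metavariable, or both come from the same position in the instantiation of the same sequence metavariable. A *thread* along an infinite branch assigns to each index $i$ in a non-empty interval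 $I\subseteq\mathbb N$ a formula occurrence in the $i$-th sequent of the branch such that the occurrence at $i+1$ is an immediate ancestor of the one at $i$ whenever $i,i+1\in I$. It is *progressing* if on some final segment of $I$ it stays on the left-hand side, always denotes one and the same formula $\alpha^*$, and is principal infinitely often. - ${}^*\mathsf L_\omega+\mathcal R$ has in addition the rule with premises $\Gamma,\alpha^{(n)},\Delta\Rightarrow\beta$ for all $n\in\mathbb N$ and conclusion $\Gamma,\alpha^*,\Delta\Rightarrow\beta$, where $\alpha^{(n)}$ is the sequence of $n$ copies of $\alpha$; its proofs are the preproofs without infinite branches. - ${}^*\mathsf L+\mathcal R$ has instead the rule with premises $\Gamma,\Delta\Rightarrow\beta$ and $\Gamma,\alpha,\alpha^*,\Delta\Rightarrow\beta$ and conclusion $\Gamma,\alpha^*,\Delta\Rightarrow\beta$; its proofs are the preproofs in which every infinite branch has a progressing thread. **Theorem.** Let $\mathcal R$ be a set of analytic rules. Then ${}^*\mathsf L_\omega+\mathcal R$ and ${}^*\mathsf L+\mathcal R$ are both sound and complete with respect to the class of $*$-continuous action lattices satisfying $Q_a(\mathcal R)$. That is, for each of the two systems and for every sequent $\alpha_1,\dots,\alpha_n\Rightarrow\beta$,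 the sequent has a proof in the system if and only if the inequation $\alpha_1\cdots\alpha_n\le\beta$ (with left-hand side $1$ if $n=0$) is valid in every $*$-continuous action lattice that satisfies all quasiequations in $Q_a(\mathcal R)$. -/

import Mathlib

/-!
Action lattices, the formula algebra, sequents, schematic rules with their principal and auxiliary
occurrences, analytic structural rules and their quasiequations, non-wellfounded preproofs, threads,
and the two proof systems (the wellfounded one and the non-wellfounded one).
-/

universe u

namespace ActionLogic

open scoped Computability

/-! ### Action lattices -/

/-- Residuated lattices: `lres x z` is `x \ z` and `rres z y` is `z / y`. -/
class ResiduatedLattice (A : Type u) extends Lattice A, Monoid A where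
  lres : A → A → A
  rres : A → A → A
  mul_le_iff_le_lres : ∀ x y z : A, x * y ≤ z ↔ y ≤ lres x z
  mul_le_iff_le_rres : ∀ x y z : A, x * y ≤ z ↔ x ≤ rres z y

/-- Action lattices; the constant `0` of the language is the least element `⊥`. -/
class ActionLattice (A : Type u) extends ResiduatedLattice A, OrderBot A, KStar A where
  one_sup_mul_star_le : ∀ x : A, 1 ⊔ x * x∗ ≤ x∗
  star_mul_le : ∀ x y : A, x * y ≤ y → x∗ * y ≤ y
  mul_star_le : ∀ x y : A, y * x ≤ y → y * x∗ ≤ y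

/-- `*`-continuity: `a∗` is the supremum of the powers of `a`. -/
def IsStarContinuous (A : Type u) [ActionLattice A] : Prop :=
  ∀ a : A, IsLUB (Set.range fun n : ℕ => a ^ n) (a∗)

/-! ### Formulas, sequents and quasiequations -/

/-- The absolutely free algebra over `ℕ` in the language of action lattices. It serves both as the
algebra of formulas (over the propositional variables) and as the algebra of metaformulas
(over the formula metavariables). -/
inductive Formula : Type
  | var (a : ℕ)
  | zero
  | one
  | inf (φ ψ : Formula)
  | sup (φ ψ : Formula)
  | mul (φ ψ : Formula)
  /-- `φ \ ψ` -/
  | lres (φ ψ : Formula)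
  /-- `φ / ψ` -/
  | rres (φ ψ : Formula)
  | star (φ : Formula)

namespace Formula

/-- The homomorphic extension of a substitution of formulas for variables. -/
def subst (σ : ℕ → Formula) : Formula → Formula
  | var a => σ a
  | zero => zero
  | one => one
  | inf φ ψ => inf (φ.subst σ) (ψ.subst σ)
  | sup φ ψ => sup (φ.subst σ) (ψ.subst σ)
  | mul φ ψ => mul (φ.subst σ) (ψ.subst σ)
  | lres φ ψ => lres (φ.subst σ) (ψ.subst σ)
  | rres φ ψ => rres (φ.subst σ) (ψ.subst σ)
  | star φ => star (φ.subst σ)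

/-- The homomorphic extension of a valuation into an action lattice. -/
def eval {A : Type u} [ActionLattice A] (v : ℕ → A) : Formula → A
  | var a => v a
  | zero => ⊥
  | one => 1
  | inf φ ψ => φ.eval v ⊓ ψ.eval v
  | sup φ ψ => φ.eval v ⊔ ψ.eval v
  | mul φ ψ => φ.eval v * ψ.eval v
  | lres φ ψ => ResiduatedLattice.lres (φ.eval v) (ψ.eval v)
  | rres φ ψ => ResiduatedLattice.rres (φ.eval v) (ψ.eval v)
  | star φ => (φ.eval v)∗

/-- The product of a finite sequence of formulas; the empty product is `1`. -/
def prod : List Formula → Formula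
  | [] => one
  | [φ] => φ
  | φ :: ψ :: l => mul φ (prod (ψ :: l))

end Formula

/-- An inequation `lhs ≤ rhs` between formulas. -/
structure Inequation where
  lhs : Formula
  rhs : Formula

/-- The inequation holds under the valuation `v`. -/
def Inequation.HoldsAt {A : Type u} [ActionLattice A] (e : Inequation) (v : ℕ → A) : Prop :=
  e.lhs.eval v ≤ e.rhs.eval v

/-- A quasiequation `e₁ & ... & eₙ ⟹ e`. -/
structure Quasiequation where
  prems : List Inequation
  concl : Inequation

/-- The action lattice `A` satisfies the quasiequation `q`. -/
def Quasiequation.Holds (q : Quasiequation) (A : Type u) [ActionLattice A] : Prop :=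
  ∀ v : ℕ → A, (∀ e ∈ q.prems, e.HoldsAt v) → q.concl.HoldsAt v

/-- A sequent `ant ⇒ succ`. -/
structure Sequent where
  ant : List Formula
  succ : Formula

/-- The inequation `α₁ ⋯ αₙ ≤ β` of the sequent `α₁, …, αₙ ⇒ β`. -/
def Sequent.toInequation (S : Sequent) : Inequation :=
  ⟨Formula.prod S.ant, S.succ⟩

/-- The inequation of the sequent `S` is valid in every `*`-continuous action lattice (in the
universe `u`) that satisfies all the quasiequations in `Q`. -/
def ValidIn (Q : Set Quasiequation) (S : Sequent) : Prop :=
  ∀ (A : Type u) [ActionLattice A], IsStarContinuous A → (∀ q ∈ Q, q.Holds A) →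
    ∀ v : ℕ → A, S.toInequation.HoldsAt v

/-! ### Schematic rules -/

/-- A metaformula occurring in a schematic rule, possibly boxed. In the conclusion of a rule the
boxed formula is the principal one, in the premises the boxed formulas are the auxiliary ones. -/
structure MFormula where
  fml : Formula
  boxed : Bool

/-- Entries of the left-hand side of a schematic sequent: sequence metavariables and
metaformulas. -/
inductive MItem : Type
  | seq (X : ℕ)
  | fml (φ : MFormula)

/-- A schematic sequent. -/
structure MSequent where
  ant : List MItem
  succ : MFormula

/-- A schematic rule. The premises are indexed by an initial segment of `ℕ`, so that rules with
infinitely many premises are covered. -/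
structure Schema where
  prem : ℕ → Option MSequent
  concl : MSequent

/-- A schematic rule with finitely many premises. -/
def Schema.ofList (prems : List MSequent) (concl : MSequent) : Schema :=
  ⟨fun i => prems[i]?, concl⟩

/-- A metavariable instantiation. -/
structure Instantiation where
  seq : ℕ → List Formula
  fml : ℕ → Formula

/-- Where a formula occurrence of an instantiated sequent comes from: position `i` of the
instantiation of the sequence metavariable `X`, the formula metavariable `p`, a boxed metaformula,
or none of these. -/
inductive Origin : Type
  | seqVar (X i : ℕ)
  | fmlVar (p : ℕ)
  | box
  | other

/-- A sequent in which every formula occurrence carries its origin. -/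
structure TracedSequent where
  ant : List (Formula × Origin)
  succ : Formula × Origin

/-- Forget the origins. -/
def TracedSequent.toSequent (S : TracedSequent) : Sequent :=
  ⟨S.ant.map Prod.fst, S.succ.1⟩

def MFormula.origin (φ : MFormula) : Origin :=
  if φ.boxed then .box else
    match φ.fml with
    | .var p => .fmlVar p
    | _ => .other

def MFormula.inst (σ : Instantiation) (φ : MFormula) : Formula × Origin :=
  (φ.fml.subst σ.fml, φ.origin)

def MItem.inst (σ : Instantiation) : MItem → List (Formula × Origin)
  | .seq X => (σ.seq X).mapIdx fun i φ => (φ, .seqVar X i)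
  | .fml φ => [φ.inst σ]

def MSequent.inst (σ : Instantiation) (S : MSequent) : TracedSequent :=
  ⟨S.ant.flatMap (MItem.inst σ), S.succ.inst σ⟩

/-- Formula occurrences of a sequent: `none` denotes the formula on the right (position `-1`)
and `some i` the `i`-th formula on the left. -/
abbrev Occ := Option ℕ

/-- The formula at an occurrence, with its origin; undefined if there is no such occurrence. -/
def TracedSequent.formulaAt (S : TracedSequent) : Occ → Option (Formula × Origin)
  | none => some S.succ
  | some i => S.ant[i]?

/-- The occurrence `o'` of the premise `P` is an immediate ancestor of the occurrence `o` of the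
conclusion `C`: both come from the same position of the same sequence metavariable, or both from the
same formula metavariable, or `o` is principal and `o'` is auxiliary. -/
def ImmediateAncestor (C P : TracedSequent) (o o' : Occ) : Prop :=
  ∃ (φ φ' : Formula) (t : Origin),
    t ≠ .other ∧ C.formulaAt o = some (φ, t) ∧ P.formulaAt o' = some (φ', t)

/-! ### The principal rules -/

namespace Schema

/-- A boxed metaformula on the left. -/
def bx (φ : Formula) : MItem := .fml ⟨φ, true⟩

/-- A sequent whose right-hand side is not boxed. -/
def sq (l : List MItem) (φ : Formula) : MSequent := ⟨l, ⟨φ, false⟩⟩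

/-- A sequent whose right-hand side is boxed. -/
def sqb (l : List MItem) (φ : Formula) : MSequent := ⟨l, ⟨φ, true⟩⟩

/-- Sequence metavariables. -/
def G : MItem := .seq 0
def D : MItem := .seq 1
def E : MItem := .seq 2

/-- Formula metavariables: `a`, `a₀`, `a₁` for displayed formulas and `b` for the right context. -/
def a : Formula := .var 0
def a₀ : Formula := .var 1
def a₁ : Formula := .var 2
def b : Formula := .var 3

def zeroL : Schema := ofList [] (sq [G, bx .zero, D] b)

def oneL : Schema := ofList [sq [G, D] b] (sq [G, bx .one, D] b)

def oneR : Schema := ofList [] (sqb [] .one)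

def infL₀ : Schema := ofList [sq [G, bx a₀, D] b] (sq [G, bx (.inf a₀ a₁), D] b)

def infL₁ : Schema := ofList [sq [G, bx a₁, D] b] (sq [G, bx (.inf a₀ a₁), D] b)

def infR : Schema := ofList [sqb [G] a₀, sqb [G] a₁] (sqb [G] (.inf a₀ a₁))

def supL : Schema :=
  ofList [sq [G, bx a₀, D] b, sq [G, bx a₁, D] b] (sq [G, bx (.sup a₀ a₁), D] b)

def supR₀ : Schema := ofList [sqb [G] a₀] (sqb [G] (.sup a₀ a₁))

def supR₁ : Schema := ofList [sqb [G] a₁] (sqb [G] (.sup a₀ a₁))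

def mulL : Schema := ofList [sq [G, bx a₀, bx a₁, D] b] (sq [G, bx (.mul a₀ a₁), D] b)

def mulR : Schema := ofList [sqb [G] a₀, sqb [D] a₁] (sqb [G, D] (.mul a₀ a₁))

def lresL : Schema :=
  ofList [sqb [D] a₀, sq [G, bx a₁, E] b] (sq [G, D, bx (.lres a₀ a₁), E] b)

def rresL : Schema :=
  ofList [sqb [D] a₀, sq [G, bx a₁, E] b] (sq [G, bx (.rres a₁ a₀), D, E] b)

def lresR : Schema := ofList [sqb [bx a₀, G] a₁] (sqb [G] (.lres a₀ a₁))

def rresR : Schema := ofList [sqb [G, bx a₀] a₁] (sqb [G] (.rres a₁ a₀))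

def starR₀ : Schema := ofList [] (sqb [] (.star a))

def starR₁ : Schema := ofList [sqb [G] a, sqb [D] (.star a)] (sqb [G, D] (.star a))

/-- The `ω`-rule for the star: one premise `Γ, α, …, α, Δ ⇒ β` (`n` copies of `α`) for every
natural number `n`. -/
def starLω : Schema :=
  ⟨fun n => some (sq (G :: (List.replicate n (bx a) ++ [D])) b), sq [G, bx (.star a), D] b⟩

/-- The finitary unfolding rule for the star. -/
def starL : Schema :=
  ofList [sq [G, D] b, sq [G, bx a, bx (.star a), D] b] (sq [G, bx (.star a), D] b)

/-- The principal rules other than the two left rules for the star. -/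
def common : Set Schema :=
  {zeroL, oneL, oneR, infL₀, infL₁, infR, supL, supR₀, supR₁, mulL, mulR, lresL, rresL, lresR,
    rresR, starR₀, starR₁}

end Schema

/-! ### Analytic structural rules -/

/-- An analytic structural rule: from the premises `Γ, Υᵢ, Δ ⇒ β`, for `Υᵢ` in the list `prems`,
infer `Γ, Υ, Δ ⇒ β`. Here `Γ`, `Δ` and the members of `Υ` are distinct sequence metavariables, `β`
is a formula metavariable, and each `Υᵢ` is a sequence of metavariables from `Υ`, possibly with
repetitions. -/
structure AnalyticRule where
  Γ : ℕ
  Δ : ℕ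
  β : ℕ
  Υ : List ℕ
  prems : List (List ℕ)
  nodup : (Γ :: Δ :: Υ).Nodup
  prems_sub : ∀ Υ' ∈ prems, ∀ X ∈ Υ', X ∈ Υ

namespace AnalyticRule

/-- The schematic sequent `Γ, l, Δ ⇒ β`. -/
def sequent (r : AnalyticRule) (l : List ℕ) : MSequent :=
  ⟨MItem.seq r.Γ :: (l.map MItem.seq ++ [MItem.seq r.Δ]), ⟨.var r.β, false⟩⟩

/-- The schematic rule; nothing is boxed. -/
def toSchema (r : AnalyticRule) : Schema :=
  Schema.ofList (r.prems.map r.sequent) (r.sequent r.Υ)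

/-- The variable that corresponds to a metavariable, under a fixed bijection between the
metavariables (sequence metavariables on the left, formula metavariables on the right) and the
variables. -/
def toVar : ℕ ⊕ ℕ ≃ ℕ := Equiv.natSumNatEquivNat

/-- The term of a sequence of sequence metavariables: the product of the variables. -/
def term (l : List ℕ) : Formula :=
  Formula.prod (l.map fun X => .var (toVar (.inl X)))

/-- The analytic quasiequation of the rule: `t(Υ₀) ≤ y & ... & t(Υₙ₋₁) ≤ y ⟹ t(Υ) ≤ y`. -/
def quasiequation (r : AnalyticRule) : Quasiequation where
  prems := r.prems.map fun l => ⟨term l, .var (toVar (.inr r.β))⟩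
  concl := ⟨term r.Υ, .var (toVar (.inr r.β))⟩

end AnalyticRule

/-! ### Preproofs and proof systems -/

/-- Rules: the identity axiom (which is not schematic), and schematic rules. -/
inductive Rule : Type
  | ident
  | schema (r : Schema)

/-- An instance of a rule, given by the instantiation that produces it. The instances of the
identity axiom are `x ⇒ x` for propositional variables `x`. -/
inductive RuleInstance : Type
  | ident (x : ℕ)
  | schema (r : Schema) (σ : Instantiation)

namespace RuleInstance

def rule : RuleInstance → Rule
  | ident _ => .ident
  | schema r _ => .schema r

def concl : RuleInstance → TracedSequent
  | ident x => ⟨[(.var x, .other)], (.var x, .other)⟩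
  | schema r σ => r.concl.inst σ

/-- The `i`-th premise, if there is one. -/
def prem : RuleInstance → ℕ → Option TracedSequent
  | ident _, _ => none
  | schema r σ, i => (r.prem i).map (MSequent.inst σ)

end RuleInstance

/-- A preproof: a possibly non-wellfounded tree of rule instances. A node `w` has a successor
`w ++ [i]` exactly if the rule instance at `w` has an `i`-th premise, and the conclusion of the rule
instance at `w ++ [i]` is that premise. -/
structure Preproof (rules : Set Rule) where
  node : List ℕ → Option RuleInstance
  root_mem : node [] ≠ none
  prefix_closed : ∀ w i, node (w ++ [i]) ≠ none → node w ≠ none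
  rule_mem : ∀ w s, node w = some s → s.rule ∈ rules
  premises : ∀ w s, node w = some s → ∀ i,
    (node (w ++ [i])).map (fun s' => s'.concl.toSequent) = (s.prem i).map TracedSequent.toSequent

namespace Preproof

variable {rules : Set Rule}

/-- The sequent at the root of the preproof is `S`. -/
def Concludes (π : Preproof rules) (S : Sequent) : Prop :=
  ∃ s, π.node [] = some s ∧ s.concl.toSequent = S

/-- An infinite branch. -/
def IsBranch (π : Preproof rules) (p : ℕ → List ℕ) : Prop :=
  p 0 = [] ∧ (∀ i, ∃ n, p (i + 1) = p i ++ [n]) ∧ ∀ i, π.node (p i) ≠ none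

/-- The formula at the occurrence `o` of the sequent at the node `w`, with its origin in the rule
instance at `w`. -/
def formulaAt (π : Preproof rules) (w : List ℕ) (o : Occ) : Option (Formula × Origin) :=
  (π.node w).bind fun s => s.concl.formulaAt o

/-- The occurrence `o'` at the `n`-th successor of the node `w` is an immediate ancestor of the
occurrence `o` at `w`. -/
def Ancestor (π : Preproof rules) (w : List ℕ) (n : ℕ) (o o' : Occ) : Prop :=
  ∃ s P, π.node w = some s ∧ s.prem n = some P ∧ ImmediateAncestor s.concl P o o'

/-- `o` is the principal occurrence at the node `w`. -/
def Principal (π : Preproof rules) (w : List ℕ) (o : Occ) : Prop :=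
  ∃ φ, π.formulaAt w o = some (φ, .box)

/-- `t`, restricted to the interval `I`, is a thread along the branch `p`. -/
def IsThread (π : Preproof rules) (p : ℕ → List ℕ) (I : Set ℕ) (t : ℕ → Occ) : Prop :=
  I.Nonempty ∧ I.OrdConnected ∧ (∀ i ∈ I, π.formulaAt (p i) (t i) ≠ none) ∧
    ∀ i, i ∈ I → i + 1 ∈ I → ∃ n, p (i + 1) = p i ++ [n] ∧ π.Ancestor (p i) n (t i) (t (i + 1))

/-- A thread that stays on the left and always denotes the same `*`-formula. -/
def IsStarThread (π : Preproof rules) (p : ℕ → List ℕ) (I : Set ℕ) (t : ℕ → Occ) : Prop :=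
  π.IsThread p I t ∧
    ∃ α : Formula, ∀ i ∈ I, t i ≠ none ∧ ∃ o, π.formulaAt (p i) (t i) = some (.star α, o)

/-- The thread `t` on `I` is progressing: its restriction to some final segment `J` of `I` is a
`*`-thread that is principal infinitely often. -/
def IsProgressing (π : Preproof rules) (p : ℕ → List ℕ) (I : Set ℕ) (t : ℕ → Occ) : Prop :=
  π.IsThread p I t ∧
    ∃ J ⊆ I, (∀ i ∈ J, ∀ j ∈ I, i ≤ j → j ∈ J) ∧ π.IsStarThread p J t ∧
      {i | i ∈ J ∧ π.Principal (p i) (t i)}.Infinite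

end Preproof

/-- A proof system: a set of rules, and a condition on the branches of preproofs. -/
structure ProofSystem where
  rules : Set Rule
  branchCondition : Preproof rules → (ℕ → List ℕ) → Prop

/-- `S` has a proof: a preproof all of whose branches satisfy the branch condition. -/
def ProofSystem.Provable (L : ProofSystem) (S : Sequent) : Prop :=
  ∃ π : Preproof L.rules, π.Concludes S ∧ ∀ p, π.IsBranch p → L.branchCondition π p

/-- The rules of the wellfounded and of the non-wellfounded system, for a given left rule for the
star. -/
def rulesWith (starLeft : Schema) (R : Set AnalyticRule) : Set Rule :=
  insert Rule.ident
    (Rule.schema '' (Schema.common ∪ {starLeft} ∪ AnalyticRule.toSchema '' R))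

/-- The wellfounded system with the `ω`-rule and the rules in `R`: no infinite branches. -/
def omegaSystem (R : Set AnalyticRule) : ProofSystem where
  rules := rulesWith Schema.starLω R
  branchCondition := fun _ _ => False

/-- The non-wellfounded system with the unfolding rule and the rules in `R`: every infinite branch
has a progressing thread. -/
def nonWellfoundedSystem (R : Set AnalyticRule) : ProofSystem where
  rules := rulesWith Schema.starL R
  branchCondition := fun π p => ∃ I t, π.IsProgressing p I t

end ActionLogic

/-! Soundness. Suppose that a sequent fails in a `*`-continuous action lattice. Number the formulas
on its left, reading `α∗` with number `n` as `α ^ n`; by residuation and `*`-continuity some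
numbering keeps the inequation false. Every rule read upwards passes this failure to a premise. The
numbers can be chosen so that an ancestor of a star never carries a larger number while it is the
same star, and a strictly smaller one after the star was principal
(`Schema.exists_failing_premise`). This gives an infinite branch of failing sequents. In the
wellfounded system there is none; in the non-wellfounded one a progressing thread along it would be
an infinite descent in `ℕ` (`Preproof.not_isProgressing`). `IsApproximation` treats both systems at
once: the wellfounded one uses exact values, the other one uses powers.

Completeness. Provability in either system is closed under the same rules (`IsRuleClosed`), the
`ω`-rule included: in the non-wellfounded system it is simulated by an infinite spine of unfoldings.
From any rule-closed predicate `P` on sequents, `ClosedSet P` is built from those sets of sequences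
that are determined by the derivability of their members in contexts. It is a `*`-continuous action
lattice, star being generated by the union of the powers, and the analytic rules yield their
quasiequations. By `canonical_eval`, the canonical value of `φ` contains `[φ]` and only sequences
that derive `φ`. A valid sequent therefore has its left-hand side in the value of its right-hand
side, and so satisfies `P`. Cut is never needed. -/

namespace ActionLogic

open scoped Computability
open ResiduatedLattice (mul_le_iff_le_lres mul_le_iff_le_rres)

/-! ### Residuated lattices and evaluation -/

section Residuated

variable {A : Type u} [ResiduatedLattice A]

instance : MulLeftMono A :=
  ⟨fun x _ _ h => (mul_le_iff_le_lres x _ _).2 (h.trans ((mul_le_iff_le_lres x _ _).1 le_rfl))⟩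

instance : MulRightMono A :=
  ⟨fun x _ _ h => (mul_le_iff_le_rres _ x _).2 (h.trans ((mul_le_iff_le_rres _ x _).1 le_rfl))⟩

/-- To bound `x * a * y`, it suffices to bound `x * b * y` for enough elements `b`. -/
theorem mul_mul_le_of_forall {ι : Sort*} {a : A} {b : ι → A}
    (h : ∀ z, (∀ i, b i ≤ z) → a ≤ z) {x y z : A} (hb : ∀ i, x * (b i * y) ≤ z) :
    x * (a * y) ≤ z := by
  rw [mul_le_iff_le_lres, mul_le_iff_le_rres]
  refine h _ fun i => ?_
  rw [← mul_le_iff_le_rres, ← mul_le_iff_le_lres]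
  exact hb i

theorem mul_lres_le (x y : A) : x * ResiduatedLattice.lres x y ≤ y :=
  (mul_le_iff_le_lres _ _ _).2 le_rfl

theorem rres_mul_le (x y : A) : ResiduatedLattice.rres y x * x ≤ y :=
  (mul_le_iff_le_rres _ _ _).2 le_rfl

end Residuated

section Eval

variable {A : Type u} [ActionLattice A]

theorem Formula.eval_prod (v : ℕ → A) :
    ∀ l : List Formula, (Formula.prod l).eval v = (l.map (Formula.eval v)).prod
  | [] => rfl
  | [φ] => by simp [Formula.prod]
  | φ :: ψ :: l => by
    rw [Formula.prod, Formula.eval, Formula.eval_prod v (ψ :: l), List.map_cons (l := ψ :: l),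
      List.prod_cons]

theorem Sequent.holdsAt_iff (S : Sequent) (v : ℕ → A) :
    S.toInequation.HoldsAt v ↔ (S.ant.map (Formula.eval v)).prod ≤ S.succ.eval v := by
  rw [Inequation.HoldsAt, Sequent.toInequation, Formula.eval_prod]

theorem mul_star_le_star (x : A) : x * x∗ ≤ x∗ :=
  le_sup_right.trans (ActionLattice.one_sup_mul_star_le x)

theorem one_le_star (x : A) : 1 ≤ x∗ :=
  le_sup_left.trans (ActionLattice.one_sup_mul_star_le x)

end Eval

/-! ### Local soundness -/

section Soundness

variable {A : Type u} [ActionLattice A]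

/-- `f φ n`, for `n : ℕ`, are lower approximations of the value of `φ`, which are exact if `φ` is
not a star. -/
structure IsApproximation (v : ℕ → A) (f : Formula → ℕ → A) : Prop where
  eval_le : ∀ φ z, (∀ n, f φ n ≤ z) → φ.eval v ≤ z
  eq_eval : ∀ φ n, (∀ α, φ ≠ .star α) → f φ n = φ.eval v

/-- The value of an item of a schematic sequent. -/
def MItem.value (f : Formula → ℕ → A) (s : ℕ → Formula) (g : ℕ → A) (μ : Formula → ℕ) : MItem → A
  | .seq X => g X
  | .fml φ => f (φ.fml.subst s) (μ φ.fml)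

/-- The approximated inequation of a schematic sequent, where `g` gives the values of the sequence
metavariables and `μ` the approximants used for the metaformulas. -/
def MSequent.HoldsWith (v : ℕ → A) (f : Formula → ℕ → A) (s : ℕ → Formula) (g : ℕ → A)
    (μ : Formula → ℕ) (S : MSequent) : Prop :=
  (S.ant.map (MItem.value f s g μ)).prod ≤ (S.succ.fml.subst s).eval v

/-- If the conclusion of the rule fails, then so does some premise, and a star approximant gets
smaller when passing from a principal to an auxiliary occurrence. -/
def Schema.LocallySound (v : ℕ → A) (f : Formula → ℕ → A) (r : Schema) : Prop :=
  ∀ s g n, ¬ r.concl.HoldsWith v f s g (fun _ => n) → ∃ i P μ, r.prem i = some P ∧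
    ¬ P.HoldsWith v f s g μ ∧ ∀ φ φ' α, MItem.fml φ ∈ r.concl.ant → MItem.fml φ' ∈ P.ant →
      φ.fml.subst s = .star α → φ'.fml.subst s = .star α → μ φ'.fml < n

theorem Schema.ofList_prem_eq_some {ps : List MSequent} {c : MSequent} {P : MSequent} (h : P ∈ ps) :
    ∃ i, (Schema.ofList ps c).prem i = some P :=
  List.mem_iff_getElem?.1 h

theorem Schema.locallySound_ofList {v : ℕ → A} {f : Formula → ℕ → A} {ps : List MSequent}
    {c : MSequent}
    (hc : ∀ s φ α, MItem.fml φ ∈ c.ant → φ.fml.subst s ≠ .star α)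
    (h : ∀ s g n, (∀ P ∈ ps, ∀ μ, P.HoldsWith v f s g μ) → c.HoldsWith v f s g (fun _ => n)) :
    (Schema.ofList ps c).LocallySound v f := by
  intro s g n hn
  have := mt (h s g n) hn
  push Not at this
  obtain ⟨P, hP, μ, hμ⟩ := this
  obtain ⟨i, hi⟩ := Schema.ofList_prem_eq_some (c := c) hP
  exact ⟨i, P, μ, hi, hμ, fun φ φ' α h₁ _ h₂ _ => (hc s φ α h₁ h₂).elim⟩

open Schema in
theorem Schema.locallySound_of_mem_common {v : ℕ → A} {f : Formula → ℕ → A}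
    (hf : IsApproximation v f) {r : Schema} (hr : r ∈ Schema.common) : r.LocallySound v f := by
  -- No principal formula on the left is a star here, so the choice of `μ` is unconstrained. A
  -- premise that holds for all numbers at the metaformula `ψ` holds with the exact value of its
  -- instance `φ`.
  have key : ∀ (φ : Formula) {x y z : A} (ψ : Formula),
      (∀ μ : Formula → ℕ, x * (f φ (μ ψ) * y) ≤ z) → x * (φ.eval v * y) ≤ z :=
    fun φ x y z ψ h => mul_mul_le_of_forall (b := f φ) (hf.eval_le φ) fun n => h fun _ => n
  simp only [Schema.common, Set.mem_insert_iff, Set.mem_singleton_iff] at hr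
  rcases hr with rfl | rfl | rfl | rfl | rfl | rfl | rfl | rfl | rfl | rfl | rfl | rfl | rfl | rfl |
    rfl | rfl | rfl <;> refine locallySound_ofList
      (by simp +contextual [sq, sqb, bx, G, D, E, a, a₀, a₁, b, Formula.subst]) fun s g n => ?_
  all_goals simp only [sq, sqb, bx, G, D, E, a, a₀, a₁, b, List.mem_cons, List.not_mem_nil,
    or_false, Formula.subst, MSequent.HoldsWith, List.map_cons, List.map_nil,
    MItem.value, List.prod_cons, List.prod_nil, mul_one, forall_eq_or_imp, forall_eq, Formula.eval,
    forall_const, le_refl, one_le_star]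
  all_goals try rw [hf.eq_eval _ _ (by simp)]
  all_goals try simp only [Formula.eval]
  -- `⊥` is the join of the empty family, so it annihilates every product.
  case inl => exact mul_mul_le_of_forall (b := Empty.elim) (fun _ _ => bot_le) (by simp)
  · simp
  · exact fun h => (mul_le_mul_right (mul_le_mul_left inf_le_left _) _).trans (key _ _ h)
  · exact fun h => (mul_le_mul_right (mul_le_mul_left inf_le_right _) _).trans (key _ _ h)
  · exact fun h => le_inf h.1 h.2
  · refine fun h => mul_mul_le_of_forall (b := fun i : Bool => cond i _ _)
      (fun z hz => sup_le (hz true) (hz false)) (Bool.forall_bool.2 ⟨key _ _ h.2, key _ _ h.1⟩)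
  · exact le_sup_of_le_left
  · exact le_sup_of_le_right
  · intro h
    rw [mul_assoc]
    refine mul_mul_le_of_forall (hf.eval_le _) fun i => ?_
    rw [← mul_assoc]
    refine mul_mul_le_of_forall (hf.eval_le _) fun j => ?_
    rw [mul_assoc]
    -- `μ` depends on the metaformula and not on its instance, so `a₀ = .var 1` and `a₁` get
    -- independent numbers even if they are instantiated by the same formula.
    exact h fun | .var 1 => i | _ => j
  · exact fun h => mul_le_mul' h.1 h.2
  · refine fun h => le_trans ?_ (key _ _ h.2)
    rw [← mul_assoc (g 1)]
    exact mul_le_mul_right (mul_le_mul_left ((mul_le_mul_left h.1 _).trans (mul_lres_le _ _)) _) _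
  · refine fun h => le_trans ?_ (key _ _ h.2)
    rw [← mul_assoc _ (g 1)]
    exact mul_le_mul_right (mul_le_mul_left ((mul_le_mul_right h.1 _).trans (rres_mul_le _ _)) _) _
  · intro h
    rw [← mul_le_iff_le_lres, mul_le_iff_le_rres]
    exact hf.eval_le _ _ fun n => (mul_le_iff_le_rres _ _ _).1 (h fun _ => n)
  · intro h
    rw [← mul_le_iff_le_rres, mul_le_iff_le_lres]
    exact hf.eval_le _ _ fun n => (mul_le_iff_le_lres _ _ _).1 (h fun _ => n)
  · exact fun h => (mul_le_mul' h.1 h.2).trans (mul_star_le_star _)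

theorem Schema.locallySound_of_quasiequation {v : ℕ → A} {f : Formula → ℕ → A} {r : AnalyticRule}
    (hr : r.quasiequation.Holds A) : r.toSchema.LocallySound v f := by
  have hval : ∀ (s : ℕ → Formula) (g : ℕ → A) (μ : Formula → ℕ) (l : List ℕ),
      (r.sequent l).HoldsWith v f s g μ ↔
        g r.Γ * ((l.map g).prod * g r.Δ) ≤ (s r.β).eval v := by
    intro s g μ l
    simp [MSequent.HoldsWith, AnalyticRule.sequent, MItem.value, Function.comp_def, Formula.subst]
  refine locallySound_ofList (by simp [AnalyticRule.sequent]) fun s g n h => ?_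
  rw [hval, mul_le_iff_le_lres, mul_le_iff_le_rres]
  -- The variable `y` is given the value `Γ \ β / Δ`: residuation moves the contexts, which the
  -- quasiequation lacks, to the right-hand side.
  have := hr (fun i => Sum.elim g (fun _ => ResiduatedLattice.rres (ResiduatedLattice.lres (g r.Γ)
    ((s r.β).eval v)) (g r.Δ)) (AnalyticRule.toVar.symm i))
  simp only [AnalyticRule.quasiequation, AnalyticRule.term, Inequation.HoldsAt, Formula.eval_prod,
    List.mem_map, forall_exists_index, and_imp, forall_apply_eq_imp_iff₂, List.map_map,
    Formula.eval, Function.comp_def, Equiv.symm_apply_apply, Sum.elim_inl, Sum.elim_inr] at this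
  refine this fun l hl => ?_
  rw [← mul_le_iff_le_rres, ← mul_le_iff_le_lres]
  exact (hval s g (fun _ => 0) l).1 (h _ (List.mem_map_of_mem hl) _)

/-- In the left star rules the auxiliary `α` is also an ancestor of the principal `α∗`. As it is
never the formula `α∗` itself, it imposes no descent condition. -/
theorem Formula.ne_star_self (φ : Formula) : φ ≠ .star φ := by
  intro h
  have := congrArg sizeOf h
  simp at this

theorem isApproximation_eval (v : ℕ → A) : IsApproximation v fun φ _ => φ.eval v :=
  ⟨fun _ _ h => h 0, fun _ _ _ => rfl⟩

-- By `*`-continuity the star is the join of the powers, so the conclusion can fail only if the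
-- premise for some power fails. The descent condition is vacuous because all auxiliary formulas are
-- copies of `α`.
open Schema in
theorem Schema.locallySound_starLω (hA : IsStarContinuous A) (v : ℕ → A) :
    starLω.LocallySound v fun φ _ => φ.eval v := by
  intro s g n hn
  by_contra! hcon
  refine hn (mul_mul_le_of_forall (a := (Formula.star (s 0)).eval v)
    (fun z hz => (hA ((s 0).eval v)).2 (Set.forall_mem_range.2 hz)) fun k => ?_)
  by_contra hk
  have hprem : ¬ (sq (G :: (List.replicate k (bx a) ++ [D])) b).HoldsWith v
      (fun φ _ => φ.eval v) s g (fun _ => 0) := by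
    simpa [starLω, MSequent.HoldsWith, sq, bx, G, D, MItem.value, a, b, Formula.subst] using hk
  obtain ⟨φ, φ', α, h₁, h₂, h₃, h₄, -⟩ := hcon k _ _ rfl hprem
  simp only [starLω, sq, G, bx, a, D, List.mem_cons, reduceCtorEq, MItem.fml.injEq,
    List.not_mem_nil, or_self, or_false, false_or, List.mem_append, List.mem_replicate] at h₁ h₂
  obtain ⟨-, rfl⟩ := h₂
  subst h₁
  simp only [Formula.subst] at h₃ h₄
  simp only [h₄, Formula.star.injEq] at h₃
  exact Formula.ne_star_self _ h₃.symm

/-- The approximation of stars by powers. -/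
def Formula.approx (v : ℕ → A) : Formula → ℕ → A
  | .star φ, n => φ.eval v ^ n
  | φ, _ => φ.eval v

theorem Formula.approx_star (v : ℕ → A) (φ : Formula) (n : ℕ) :
    (Formula.star φ).approx v n = φ.eval v ^ n := rfl

theorem isApproximation_approx (hA : IsStarContinuous A) (v : ℕ → A) :
    IsApproximation v (Formula.approx v) := by
  constructor
  · intro φ z h
    cases φ
    case star φ => exact (hA (φ.eval v)).2 (Set.forall_mem_range.2 h)
    all_goals exact h 0
  · intro φ n h
    cases φ
    case star φ => exact (h _ rfl).elim
    all_goals rfl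

-- The number of the principal star selects the premise: `α ^ 0 = 1` makes the left premise fail,
-- and `α ^ (n + 1) = α * α ^ n` makes the right premise fail with the new star numbered `n`.
open Schema in
theorem Schema.locallySound_starL (hA : IsStarContinuous A) (v : ℕ → A) :
    starL.LocallySound v (Formula.approx v) := by
  intro s g n hn
  by_contra! hcon
  refine hn ?_
  have h₀ := hcon 0 _ (fun _ => 0) rfl
  have h₁ := fun μ => hcon 1 _ μ rfl
  simp only [MSequent.HoldsWith, starL, sq, G, bx, a, D, b, List.map_cons, List.map_nil,
    MItem.value, List.prod_cons, List.prod_nil, mul_one, List.mem_cons, List.not_mem_nil,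
    reduceCtorEq, false_or, or_false, MItem.fml.injEq, Formula.subst, ofList,
    Formula.approx_star, false_and, and_false, exists_false, imp_false, not_not] at h₀ h₁ ⊢
  cases n with
  | zero => simpa using h₀
  | succ n =>
    rw [pow_succ', mul_assoc]
    refine mul_mul_le_of_forall ((isApproximation_approx hA v).eval_le (s 0)) fun k => ?_
    by_contra hk
    -- The variable case is the auxiliary `α`, numbered by the approximant `k`; the remaining case
    -- is its star, numbered `n`.
    obtain ⟨φ, φ', α, rfl, h₂, h₃, h₄, h₅⟩ := h₁ (fun | .var _ => k | _ => n) hk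
    rcases h₂ with rfl | rfl
    · simp only [Formula.subst] at h₃ h₄
      simp only [h₄, Formula.star.injEq] at h₃
      exact Formula.ne_star_self _ h₃.symm
    · exact absurd h₅ (by simp)

end Soundness
/-! ### Failing branches -/

theorem map_mapIdx {α β γ : Type*} (f : β → γ) (g : ℕ → α → β) (l : List α) :
    (l.mapIdx g).map f = l.mapIdx fun i x => f (g i x) := by
  apply List.ext_getElem?
  simp [Function.comp_def]

/-- The sequence metavariable of an item. -/
def MItem.key : MItem → Option ℕ
  | .seq X => some X
  | .fml _ => none

/-- The sequence metavariables on the left of the conclusion are distinct, and there is at most one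
metaformula, which is boxed. -/
structure Schema.IsLinear (r : Schema) : Prop where
  nodup : (r.concl.ant.map MItem.key).Nodup
  boxed : ∀ φ, MItem.fml φ ∈ r.concl.ant → φ.boxed = true

open Schema in
theorem Schema.isLinear_of_mem_common {r : Schema} (hr : r ∈ common) : r.IsLinear := by
  simp only [common, Set.mem_insert_iff, Set.mem_singleton_iff] at hr
  rcases hr with rfl | rfl | rfl | rfl | rfl | rfl | rfl | rfl | rfl | rfl | rfl | rfl | rfl | rfl |
    rfl | rfl | rfl <;> constructor <;>
    simp [zeroL, oneL, oneR, infL₀, infL₁, infR, supL, supR₀, supR₁, mulL, mulR, lresL, rresL,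
      lresR, rresR, starR₀, starR₁, ofList, sq, sqb, bx, G, D, E, MItem.key]

open Schema in
theorem Schema.isLinear_starL : starL.IsLinear := by
  constructor <;> simp [starL, ofList, sq, bx, G, D, MItem.key]

open Schema in
theorem Schema.isLinear_starLω : starLω.IsLinear := by
  constructor <;> simp [starLω, sq, bx, G, D, MItem.key]

theorem AnalyticRule.isLinear_toSchema (r : AnalyticRule) : r.toSchema.IsLinear := by
  have := r.nodup
  refine ⟨?_, by simp [toSchema, Schema.ofList, sequent]⟩
  simp only [toSchema, Schema.ofList, sequent, List.map_cons, List.map_append, List.map_map,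
    List.map_nil, MItem.key]
  have h : List.Nodup (r.Γ :: (r.Υ ++ [r.Δ])) := by
    simp only [List.nodup_cons, List.mem_cons, not_or] at this
    simp [List.nodup_append, this.1.1, this.1.2, this.2.2]
    exact fun a ha h => this.2.1 (h ▸ ha)
  simpa [Function.comp_def, MItem.key] using h.map (Option.some_injective ℕ)

/-- The origins on the left of the conclusion of a linear rule are distinct. -/
theorem Schema.IsLinear.nodup_origin {r : Schema} (hr : r.IsLinear) (σ : Instantiation) :
    ((r.concl.inst σ).ant.map Prod.snd).Nodup := by
  obtain ⟨h₁, h₂⟩ := hr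
  rw [MSequent.inst, List.map_flatMap, List.nodup_flatMap]
  constructor
  · rintro (X | φ) -
    · rw [MItem.inst, List.nodup_iff_injective_get]
      intro i j h
      simpa [Fin.ext_iff] using h
    · simp [MItem.inst]
  · rw [List.Nodup, List.pairwise_map] at h₁
    refine h₁.imp_of_mem ?_
    rintro (X | φ) (Y | ψ) hX hY h
    · simp only [MItem.key, ne_eq, Option.some.injEq] at h
      simp [Function.onFun, MItem.inst, List.disjoint_left, List.mem_mapIdx]
      intros; grind
    · simp [Function.onFun, MItem.inst, MFormula.inst, MFormula.origin, h₂ _ hY, List.mem_mapIdx]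
    · simp [Function.onFun, MItem.inst, MFormula.inst, MFormula.origin, h₂ _ hX, List.mem_mapIdx]
    · simp [MItem.key] at h

/-- Turns numbers attached to positions into numbers attached to origins. Premises share origins
with the conclusion, so the numbers can then be carried over to them. -/
theorem exists_map_eq_of_nodup {α β γ : Type*} [DecidableEq β] [Nonempty γ] :
    ∀ (L : List (α × β)) (T : List (α × γ)), T.map Prod.fst = L.map Prod.fst →
      (L.map Prod.snd).Nodup → ∃ ν : β → γ, T = L.map fun x => (x.1, ν x.2)
  | [], T, h, _ => ⟨fun _ => Classical.arbitrary _, by simpa using h⟩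
  | x :: L, T, h, hL => by
    obtain ⟨y, T, rfl⟩ : ∃ y T', T = y :: T' :=
      List.exists_cons_of_ne_nil (by rintro rfl; simp at h)
    simp only [List.map_cons, List.cons.injEq, List.nodup_cons] at h hL
    obtain ⟨ν, rfl⟩ := exists_map_eq_of_nodup L T h.2 hL.2
    refine ⟨Function.update ν x.2 y.2, ?_⟩
    simp only [List.map_cons, Function.update_self, List.cons.injEq, List.map_inj_left]
    refine ⟨Prod.ext h.1 rfl, fun z hz => ?_⟩
    have hzx : z.2 ≠ x.2 := fun hzx => hL.1 (hzx ▸ List.mem_map_of_mem hz)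
    rw [Function.update_of_ne hzx]

/-- The items of a schematic sequent, instantiated, with annotations. -/
def MItem.annotate (σ : Instantiation) (ν : Origin → ℕ) (μ : Formula → ℕ) :
    MItem → List ((Formula × Origin) × ℕ)
  | .seq X => (σ.seq X).mapIdx fun i φ => ((φ, .seqVar X i), ν (.seqVar X i))
  | .fml φ => [(φ.inst σ, μ φ.fml)]

theorem MItem.map_fst_annotate (σ : Instantiation) (ν : Origin → ℕ) (μ : Formula → ℕ) (m : MItem) :
    (m.annotate σ ν μ).map Prod.fst = m.inst σ := by
  cases m <;> simp [annotate, inst, map_mapIdx]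

/-- The values of the sequence metavariables. -/
def Instantiation.value {A : Type u} [ActionLattice A] (σ : Instantiation) (ν : Origin → ℕ)
    (f : Formula → ℕ → A) (X : ℕ) : A :=
  ((σ.seq X).mapIdx fun i φ => f φ (ν (.seqVar X i))).prod

theorem MItem.prod_annotate {A : Type u} [ActionLattice A] (f : Formula → ℕ → A)
    (σ : Instantiation) (ν : Origin → ℕ) (μ : Formula → ℕ) (l : List MItem) :
    ((l.flatMap (MItem.annotate σ ν μ)).map fun x => f x.1.1 x.2).prod =
      (l.map (MItem.value f σ.fml (σ.value ν f) μ)).prod := by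
  rw [List.map_flatMap, List.flatMap_def, List.prod_flatten, List.map_map]
  congr 2
  funext m
  cases m <;> simp [annotate, value, Instantiation.value, map_mapIdx, MFormula.inst]

/-- An annotation of the left-hand side of the sequent such that the approximated inequation
fails. -/
structure Sequent.FailsWith {A : Type u} [ActionLattice A] (v : ℕ → A) (f : Formula → ℕ → A)
    (S : Sequent) (T : List (Formula × ℕ)) : Prop where
  map_fst : T.map Prod.fst = S.ant
  not_le : ¬ (T.map fun x => f x.1 x.2).prod ≤ S.succ.eval v

/-- The annotations of stars do not increase from the conclusion `C` to the premise `P`, and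
decrease if the star is principal. -/
def AnnotationDecreases (C P : TracedSequent) (T T' : List (Formula × ℕ)) : Prop :=
  ∀ i j α a b, T[i]? = some (.star α, a) → T'[j]? = some (.star α, b) →
    ImmediateAncestor C P (some i) (some j) →
      b ≤ a ∧ (∀ φ, C.formulaAt (some i) = some (φ, .box) → b < a)

section

variable {A : Type u} [ActionLattice A] {v : ℕ → A} {f : Formula → ℕ → A}

/-- Numbers travel along origins. A formula from a sequence metavariable keeps its number in every
premise, while auxiliary formulas get theirs from local soundness. An immediate ancestor shares the
origin, so its number is either equal or, for the origin `.box`, governed by the strict descent in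
`Schema.LocallySound`. -/
theorem Schema.exists_failing_premise {r : Schema} (hlin : r.IsLinear)
    (hr : r.LocallySound v f) (σ : Instantiation) (T : List (Formula × ℕ))
    (hT : (r.concl.inst σ).toSequent.FailsWith v f T) :
    ∃ i P T', (RuleInstance.schema r σ).prem i = some P ∧ P.toSequent.FailsWith v f T' ∧
      AnnotationDecreases (r.concl.inst σ) P T T' := by
  classical
  obtain ⟨hT, hfail⟩ := hT
  obtain ⟨ν, rfl⟩ := exists_map_eq_of_nodup (r.concl.inst σ).ant T hT (hlin.nodup_origin σ)
  have hconcl : (r.concl.inst σ).ant.map (fun x => (x.1, ν x.2)) =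
      (r.concl.ant.flatMap (MItem.annotate σ ν fun _ => ν .box)).map fun x => (x.1.1, x.2) := by
    rw [MSequent.inst, List.map_flatMap, List.map_flatMap]
    refine List.flatMap_congr ?_
    rintro (X | φ) hm
    · simp [MItem.inst, MItem.annotate, map_mapIdx]
    · simp [MItem.inst, MItem.annotate, MFormula.inst, MFormula.origin, hlin.boxed φ hm]
  rw [hconcl, List.map_map, Function.comp_def, MItem.prod_annotate] at hfail
  obtain ⟨i, P, μ, hP, hPfail, hdec⟩ := hr σ.fml (σ.value ν f) (ν .box) hfail
  have hfst : (P.ant.flatMap (MItem.annotate σ ν μ)).map Prod.fst = (P.inst σ).ant := by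
    rw [MSequent.inst, List.map_flatMap]
    exact List.flatMap_congr fun m _ => m.map_fst_annotate σ ν μ
  refine ⟨i, P.inst σ, (P.ant.flatMap (MItem.annotate σ ν μ)).map fun x => (x.1.1, x.2),
    by simp [RuleInstance.prem, hP], ⟨?_, ?_⟩, ?_⟩
  · rw [TracedSequent.toSequent, ← hfst, List.map_map, List.map_map]
    rfl
  · rwa [List.map_map, Function.comp_def, MItem.prod_annotate]
  · rintro k j α a b ha hb ⟨φ, φ', t, ht, hk, hj⟩
    simp only [TracedSequent.formulaAt] at hk hj ⊢
    simp only [List.getElem?_map, hk, Option.map_some, Option.some.injEq, Prod.mk.injEq] at ha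
    obtain ⟨rfl, rfl⟩ := ha
    rw [← hfst, List.getElem?_map, Option.map_eq_some_iff] at hj
    obtain ⟨⟨y, b'⟩, hy, rfl⟩ := hj
    simp only [List.getElem?_map, hy, Option.map_some, Option.some.injEq, Prod.mk.injEq] at hb
    obtain ⟨rfl, rfl⟩ := hb
    obtain ⟨m', hm', hmem'⟩ := List.mem_flatMap.1 (List.mem_of_getElem? hy)
    obtain ⟨m, hm, hmem⟩ := List.mem_flatMap.1 (List.mem_of_getElem? hk)
    -- `ν .box` is the number of the principal formula.
    have hne : t = .box → b' < ν t := by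
      rintro rfl
      rcases m with X | ψ
      · simp [MItem.inst, List.mem_mapIdx] at hmem
      rcases m' with X | ψ'
      · simp [MItem.annotate, List.mem_mapIdx] at hmem'
      simp only [MItem.inst, MItem.annotate, MFormula.inst, List.mem_singleton,
        Prod.mk.injEq] at hmem hmem'
      rw [hmem'.2]
      exact hdec ψ ψ' α hm hm' hmem.1.symm hmem'.1.1.symm
    refine ⟨?_, ?_⟩
    -- Linearity makes every metaformula on the left of the conclusion boxed, so any other origin
    -- there is a position of a sequence metavariable, whose number is copied.
    · by_cases htb : t = .box
      · exact (hne htb).le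
      rcases m with X | ψ
      · rcases m' with Y | ψ'
        · simp only [MItem.annotate, List.mem_mapIdx, Prod.mk.injEq] at hmem'
          obtain ⟨_, _, ⟨_, rfl⟩, rfl⟩ := hmem'
          exact le_rfl
        · simp only [MItem.inst, MItem.annotate, MFormula.inst, List.mem_singleton,
            Prod.mk.injEq, List.mem_mapIdx] at hmem hmem'
          obtain ⟨_, _, _, rfl⟩ := hmem
          have := hmem'.1.2
          rw [MFormula.origin] at this
          split_ifs at this
          split at this <;> simp at this
      · simp only [MItem.inst, MFormula.inst, List.mem_singleton, Prod.mk.injEq, MFormula.origin,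
          hlin.boxed ψ hm, if_true] at hmem
        exact (htb hmem.2).elim
    · intro φ hφ
      rw [hk] at hφ
      simp only [Option.some.injEq, Prod.mk.injEq] at hφ
      exact hne hφ.2

theorem RuleInstance.exists_failing_premise {starLeft : Schema} {R : Set AnalyticRule}
    (hf : IsApproximation v f) (hlin : starLeft.IsLinear) (hstar : starLeft.LocallySound v f)
    (hR : ∀ q ∈ AnalyticRule.quasiequation '' R, q.Holds A) (s : RuleInstance)
    (hs : s.rule ∈ rulesWith starLeft R) (T : List (Formula × ℕ))
    (hT : s.concl.toSequent.FailsWith v f T) :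
    ∃ i P T', s.prem i = some P ∧ P.toSequent.FailsWith v f T' ∧
      AnnotationDecreases s.concl P T T' := by
  cases s with
  | ident x =>
    obtain ⟨h₁, h₂⟩ := hT
    refine (h₂ ?_).elim
    simp only [concl, TracedSequent.toSequent, List.map_cons, List.map_nil,
      List.map_eq_singleton_iff] at h₁
    obtain ⟨⟨φ, n⟩, rfl, rfl⟩ := h₁
    simp [hf.eq_eval (.var x) n (by simp), concl, TracedSequent.toSequent]
  | schema r σ =>
    simp only [rule, rulesWith, Set.mem_insert_iff, reduceCtorEq, false_or, Set.mem_image,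
      Rule.schema.injEq, exists_eq_right, Set.mem_union, Set.mem_singleton_iff] at hs
    rcases hs with (hr | rfl) | ⟨r, hr, rfl⟩
    · exact Schema.exists_failing_premise (Schema.isLinear_of_mem_common hr)
        (Schema.locallySound_of_mem_common hf hr) σ T hT
    · exact Schema.exists_failing_premise hlin hstar σ T hT
    · exact Schema.exists_failing_premise r.isLinear_toSchema
        (Schema.locallySound_of_quasiequation (hR _ ⟨r, hr, rfl⟩)) σ T hT

/-- Residuating the tail away shows that some approximant of the head already makes the product
fail; residuating that approximant away leaves a failing inequation for the tail alone. -/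
theorem exists_annotation_of_not_le (hf : IsApproximation v f) :
    ∀ (l : List Formula) (z : A), ¬ (l.map (Formula.eval v)).prod ≤ z →
      ∃ T : List (Formula × ℕ), T.map Prod.fst = l ∧ ¬ (T.map fun x => f x.1 x.2).prod ≤ z
  | [], z, h => ⟨[], rfl, h⟩
  | φ :: l, z, h => by
    by_contra! hcon
    refine h ?_
    rw [List.map_cons, List.prod_cons, mul_le_iff_le_rres]
    refine hf.eval_le _ _ fun n => ?_
    rw [← mul_le_iff_le_rres, mul_le_iff_le_lres]
    by_contra hn
    obtain ⟨T, rfl, hT⟩ := exists_annotation_of_not_le hf l _ hn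
    refine hT ?_
    rw [← mul_le_iff_le_lres]
    simpa using hcon ((φ, n) :: T) (by simp)

/-- If the sequent at the root of a preproof fails, then there is a branch of failing sequents. -/
theorem Preproof.exists_failing_branch {starLeft : Schema} {R : Set AnalyticRule}
    (hf : IsApproximation v f) (hlin : starLeft.IsLinear) (hstar : starLeft.LocallySound v f)
    (hR : ∀ q ∈ AnalyticRule.quasiequation '' R, q.Holds A)
    (π : Preproof (rulesWith starLeft R)) {S : Sequent} (hS : π.Concludes S)
    (hfail : ¬ S.toInequation.HoldsAt v) :
    ∃ p, π.IsBranch p ∧ ∃ T : ℕ → List (Formula × ℕ), ∀ i, ∃ s n P,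
      π.node (p i) = some s ∧ (T i).map Prod.fst = s.concl.toSequent.ant ∧
        p (i + 1) = p i ++ [n] ∧ s.prem n = some P ∧
          AnnotationDecreases s.concl P (T i) (T (i + 1)) := by
  -- Stated for all pairs, with failure as a premise, so that the choice is a total function that
  -- can be iterated; at other pairs its value is irrelevant.
  have step : ∀ x : List ℕ × List (Formula × ℕ), ∃ y : List ℕ × List (Formula × ℕ),
      ∀ s, π.node x.1 = some s → s.concl.toSequent.FailsWith v f x.2 →
        ∃ n P s', y.1 = x.1 ++ [n] ∧ s.prem n = some P ∧ π.node y.1 = some s' ∧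
          s'.concl.toSequent.FailsWith v f y.2 ∧ AnnotationDecreases s.concl P x.2 y.2 := by
    intro x
    by_cases h : ∃ s, π.node x.1 = some s ∧ s.concl.toSequent.FailsWith v f x.2
    · obtain ⟨s, hs, hT⟩ := h
      obtain ⟨n, P, T', hP, hT', hdec⟩ :=
        s.exists_failing_premise hf hlin hstar hR (π.rule_mem _ _ hs) _ hT
      have := π.premises _ _ hs n
      rw [hP, Option.map_some, Option.map_eq_some_iff] at this
      obtain ⟨s', hs', hs'P⟩ := this
      refine ⟨(x.1 ++ [n], T'), fun s₂ hs₂ _ => ?_⟩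
      obtain rfl : s = s₂ := Option.some.inj (hs.symm.trans hs₂)
      exact ⟨n, P, s', rfl, hP, hs', hs'P ▸ hT', hdec⟩
    · push Not at h
      exact ⟨x, fun s hs hT => (h s hs hT).elim⟩
  choose next hnext using step
  obtain ⟨s₀, hs₀, rfl⟩ := hS
  rw [Sequent.holdsAt_iff] at hfail
  obtain ⟨T₀, hT₀, hT₀fail⟩ := exists_annotation_of_not_le hf _ _ hfail
  let x : ℕ → List ℕ × List (Formula × ℕ) := fun i => next^[i] ([], T₀)
  have hx : ∀ i, x (i + 1) = next (x i) := fun i => Function.iterate_succ_apply' _ _ _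
  have inv : ∀ i, ∃ s, π.node (x i).1 = some s ∧ s.concl.toSequent.FailsWith v f (x i).2 := by
    intro i
    induction i with
    | zero => exact ⟨s₀, hs₀, hT₀, hT₀fail⟩
    | succ i ih =>
      obtain ⟨s, hs, hT⟩ := ih
      obtain ⟨n, P, s', -, -, h₁, h₂, -⟩ := hnext _ s hs hT
      rw [← hx] at h₁ h₂
      exact ⟨s', h₁, h₂⟩
  refine ⟨fun i => (x i).1, ⟨rfl, fun i => ?_, fun i => ?_⟩, fun i => (x i).2, fun i => ?_⟩
  all_goals
    obtain ⟨s, hs, hT⟩ := inv i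
    obtain ⟨n, P, s', h₁, h₂, h₃, h₄, h₅⟩ := hnext _ s hs hT
    rw [← hx] at h₁ h₅
  · exact ⟨n, h₁⟩
  · simp [hs]
  · exact ⟨s, n, P, hs, hT.map_fst, h₁, h₂, h₅⟩

/-- Along a branch whose annotations decrease there is no progressing thread. -/
theorem Preproof.not_isProgressing {rules : Set Rule} (π : Preproof rules) {p : ℕ → List ℕ}
    {T : ℕ → List (Formula × ℕ)}
    (hT : ∀ i, ∃ s n P, π.node (p i) = some s ∧ (T i).map Prod.fst = s.concl.toSequent.ant ∧
      p (i + 1) = p i ++ [n] ∧ s.prem n = some P ∧ AnnotationDecreases s.concl P (T i) (T (i + 1)))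
    (I : Set ℕ) (t : ℕ → Occ) : ¬ π.IsProgressing p I t := by
  rintro ⟨-, J, -, -, ⟨⟨-, hconn, -, hanc⟩, α, hα⟩, hinf⟩
  -- `a i` is the number of the thread's star in the `i`-th sequent; outside `J` its value plays no
  -- role.
  have hann : ∀ i, ∃ a, i ∈ J → ∃ k, t i = some k ∧ (T i)[k]? = some (.star α, a) := by
    intro i
    by_cases hi : i ∈ J
    swap
    · exact ⟨0, fun h => (hi h).elim⟩
    obtain ⟨hne, o, ho⟩ := hα i hi
    obtain ⟨k, hk⟩ := Option.ne_none_iff_exists'.1 hne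
    obtain ⟨s, _, _, hs, hfst, -⟩ := hT i
    rw [Preproof.formulaAt, hs, Option.bind_some, hk, TracedSequent.formulaAt] at ho
    have : ((T i).map Prod.fst)[k]? = some (.star α) := by
      rw [hfst, TracedSequent.toSequent, List.getElem?_map, ho, Option.map_some]
    rw [List.getElem?_map, Option.map_eq_some_iff] at this
    obtain ⟨⟨_, a⟩, h, rfl⟩ := this
    exact ⟨a, fun _ => ⟨k, hk, h⟩⟩
  choose a ha using hann
  -- `J` is an interval and contains arbitrarily large indices.
  have hmem : ∀ i ∈ J, ∀ j, i ≤ j → j ∈ J := by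
    intro i hi j hij
    obtain ⟨k, ⟨hk, -⟩, hjk⟩ := hinf.exists_gt j
    exact hconn.out hi hk ⟨hij, hjk.le⟩
  have hstep : ∀ i ∈ J, a (i + 1) ≤ a i ∧ (π.Principal (p i) (t i) → a (i + 1) < a i) := by
    intro i hi
    have hi' := hmem i hi (i + 1) i.le_succ
    obtain ⟨k, hk, hka⟩ := ha i hi
    obtain ⟨k', hk', hka'⟩ := ha (i + 1) hi'
    obtain ⟨s, n, P, hs, -, hp, hP, hdec⟩ := hT i
    obtain ⟨n', hp', s', P', hs', hP', hanc⟩ := hanc i hi hi'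
    obtain rfl : s = s' := Option.some.inj (hs.symm.trans hs')
    obtain rfl : n = n' := by simpa using hp.symm.trans hp'
    obtain rfl : P = P' := Option.some.inj (hP.symm.trans hP')
    rw [hk, hk'] at hanc
    refine ⟨(hdec k k' α _ _ hka hka' hanc).1, fun ⟨φ, hφ⟩ => ?_⟩
    refine (hdec k k' α _ _ hka hka' hanc).2 φ ?_
    rwa [Preproof.formulaAt, hs, Option.bind_some, hk] at hφ
  have hanti : ∀ i ∈ J, ∀ j, i ≤ j → a j ≤ a i := by
    intro i hi j hij
    induction j, hij using Nat.le_induction with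
    | base => exact le_rfl
    | succ j hij ih => exact (hstep j (hmem i hi j hij)).1.trans ih
  -- Infinite descent: beyond `i` there is a principal index, after which the number is smaller than
  -- `a i`.
  have hfalse : ∀ N, ∀ i ∈ J, a i = N → False := by
    intro N
    induction N using Nat.strong_induction_on with
    | _ N ih =>
      rintro i hi rfl
      obtain ⟨j, ⟨hj, hprin⟩, hij⟩ := hinf.exists_gt i
      exact ih (a (j + 1)) (((hstep j hj).2 hprin).trans_le (hanti i hi j hij.le)) (j + 1)
        (hmem j hj _ j.le_succ) rfl
  obtain ⟨i, hi, -⟩ := hinf.nonempty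
  exact hfalse _ i hi rfl

end

/-! ### Soundness of the two systems -/

theorem validIn_of_provable_omegaSystem {R : Set AnalyticRule} {S : Sequent}
    (h : (omegaSystem R).Provable S) : ValidIn.{u} (AnalyticRule.quasiequation '' R) S := by
  intro A _ hA hR v
  by_contra hfail
  obtain ⟨π, hS, hπ⟩ := h
  obtain ⟨p, hp, -⟩ := Preproof.exists_failing_branch (isApproximation_eval v)
    Schema.isLinear_starLω (Schema.locallySound_starLω hA v) hR π hS hfail
  exact hπ p hp

theorem validIn_of_provable_nonWellfoundedSystem {R : Set AnalyticRule} {S : Sequent}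
    (h : (nonWellfoundedSystem R).Provable S) :
    ValidIn.{u} (AnalyticRule.quasiequation '' R) S := by
  intro A _ hA hR v
  by_contra hfail
  obtain ⟨π, hS, hπ⟩ := h
  obtain ⟨p, hp, T, hT⟩ := Preproof.exists_failing_branch (isApproximation_approx hA v)
    Schema.isLinear_starL (Schema.locallySound_starL hA v) hR π hS hfail
  obtain ⟨I, t, ht⟩ := hπ p hp
  exact π.not_isProgressing hT I t ht

/-! ### Grafting preproofs -/

/-- The sequent at the root. -/
def Preproof.concl {rules : Set Rule} (π : Preproof rules) : Sequent :=
  ((π.node []).get (Option.isSome_iff_ne_none.2 π.root_mem)).concl.toSequent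

theorem Preproof.concludes_iff {rules : Set Rule} (π : Preproof rules) (S : Sequent) :
    π.Concludes S ↔ π.concl = S := by
  obtain ⟨s, hs⟩ := Option.ne_none_iff_exists'.1 π.root_mem
  simp [Concludes, concl, hs]

section Graft

variable {rules : Set Rule} {Q : Type} (label : Q → RuleInstance)
  (next : Q → ℕ → Option (Q ⊕ Preproof rules))

/-- The rule instances of a tree that is generated by a system of states. The successors of a state
are states and preproofs. -/
def graftNode : Q → List ℕ → Option RuleInstance
  | q, [] => some (label q)
  | q, i :: w =>
    match next q i with
    | none => none
    | some (.inl q') => graftNode q' w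
    | some (.inr π) => π.node w

/-- The state at a node, if there is one. -/
def graftState : Q → List ℕ → Option Q
  | q, [] => some q
  | q, i :: w =>
    match next q i with
    | some (.inl q') => graftState q' w
    | _ => none

/-- The rule instances at the states fit together. -/
def GraftFits : Prop :=
  ∀ q i, (next q i).map (Sum.elim (fun q' => (label q').concl.toSequent) Preproof.concl) =
    ((label q).prem i).map TracedSequent.toSequent

variable {label next}

/-- The preproof generated by a system of states. -/
def Preproof.graft (hfit : GraftFits label next) (hmem : ∀ q, (label q).rule ∈ rules) (q : Q) :
    Preproof rules where
  node := graftNode label next q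
  root_mem := by simp [graftNode]
  prefix_closed w i := by
    induction w generalizing q with
    | nil => simp [graftNode]
    | cons j w ih =>
      rw [List.cons_append, graftNode, graftNode]
      rcases next q j with _ | q' | π
      · exact id
      · exact ih q'
      · exact π.prefix_closed w i
  rule_mem w s := by
    induction w generalizing q with
    | nil =>
      rintro ⟨⟩
      exact hmem q
    | cons j w ih =>
      rw [graftNode]
      rcases next q j with _ | q' | π
      · simp
      · exact ih q'
      · exact π.rule_mem w s
  premises w s := by
    induction w generalizing q with
    | nil =>
      rintro ⟨⟩ i
      rw [← hfit q i, List.nil_append, graftNode]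
      rcases next q i with _ | q' | π
      · rfl
      · rfl
      · obtain ⟨s, hs⟩ := Option.ne_none_iff_exists'.1 π.root_mem
        simp [concl, hs]
    | cons j w ih =>
      simp only [List.cons_append, graftNode]
      rcases next q j with _ | q' | π
      · simp
      · exact ih q'
      · exact π.premises w s

theorem graftNode_append {q q' : Q} {u : List ℕ} (h : graftState next q u = some q')
    (w : List ℕ) : graftNode label next q (u ++ w) = graftNode label next q' w := by
  induction u generalizing q with
  | nil =>
    cases h
    rfl
  | cons i u ih =>
    rw [List.cons_append, graftNode]
    rw [graftState] at h
    rcases hn : next q i with _ | q₁ | π <;> rw [hn] at h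
    · cases h
    · exact ih h
    · cases h

theorem graftState_append {q q' : Q} {u : List ℕ} (h : graftState next q u = some q')
    (w : List ℕ) : graftState next q (u ++ w) = graftState next q' w := by
  induction u generalizing q with
  | nil =>
    cases h
    rfl
  | cons i u ih =>
    rw [List.cons_append, graftState]
    rw [graftState] at h
    rcases hn : next q i with _ | q₁ | π <;> rw [hn] at h
    · cases h
    · exact ih h
    · cases h

/-- A branch stays within the states, or else enters one of the grafted preproofs. -/
theorem Preproof.graft_branch (hfit : GraftFits label next) (hmem : ∀ q, (label q).rule ∈ rules)
    {q : Q} {p : ℕ → List ℕ} (hp : (Preproof.graft hfit hmem q).IsBranch p) :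
    (∀ i, ∃ q', graftState next q (p i) = some q') ∨
      ∃ m q' n π p', next q' n = some (.inr π) ∧ π.IsBranch p' ∧ (∀ j, p (m + j) = p m ++ p' j) ∧
        ∀ w, (Preproof.graft hfit hmem q).node (p m ++ w) = π.node w := by
  classical
  refine or_iff_not_imp_left.2 fun hex => ?_
  push Not at hex
  obtain ⟨hp₀, hpsucc, hpnode⟩ := hp
  -- `m` is the first index at which the branch is no longer at a state. It is not the root, and the
  -- successor of the last state must be the root of a grafted preproof.
  obtain ⟨m, hm, hmin⟩ : ∃ m, (∀ q', graftState next q (p m) ≠ some q') ∧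
      ∀ k < m, ∃ q', graftState next q (p k) = some q' :=
    ⟨Nat.find hex, Nat.find_spec hex, fun k hk => by simpa using Nat.find_min hex hk⟩
  obtain _ | k := m
  · exact (hm q (by rw [hp₀]; rfl)).elim
  obtain ⟨q', hq'⟩ := hmin k k.lt_succ_self
  obtain ⟨n, hn⟩ := hpsucc k
  have hnode : ∀ w, (Preproof.graft hfit hmem q).node (p (k + 1) ++ w) =
      graftNode label next q' (n :: w) := by
    intro w
    rw [hn, List.append_assoc]
    exact graftNode_append hq' _
  rcases hnext : next q' n with _ | q₁ | π
  · refine (hpnode (k + 1) ?_).elim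
    rw [← List.append_nil (p (k + 1)), hnode, graftNode, hnext]
  · refine (hm q₁ ?_).elim
    rw [hn, graftState_append hq', graftState, hnext]
    rfl
  have hnode' : ∀ w, (Preproof.graft hfit hmem q).node (p (k + 1) ++ w) = π.node w := by
    intro w
    rw [hnode, graftNode, hnext]
  have hprefix : ∀ j, ∃ r, p (k + 1 + j) = p (k + 1) ++ r := by
    intro j
    induction j with
    | zero => exact ⟨[], by simp⟩
    | succ j ih =>
      obtain ⟨r, hr⟩ := ih
      obtain ⟨i, hi⟩ := hpsucc (k + 1 + j)
      exact ⟨r ++ [i], by rw [← add_assoc, hi, hr, List.append_assoc]⟩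
  choose p' hp' using hprefix
  refine ⟨k + 1, q', n, π, p', hnext, ⟨?_, fun j => ?_, fun j => ?_⟩, hp', hnode'⟩
  · simpa using (hp' 0).symm
  · obtain ⟨i, hi⟩ := hpsucc (k + 1 + j)
    rw [hp' j, add_assoc, hp' (j + 1), List.append_assoc, List.append_cancel_left_eq] at hi
    exact ⟨i, hi⟩
  · rw [← hnode', ← hp']
    exact hpnode _

end Graft

/-! ### Closure of provability under rules -/

/-- A branch satisfies the branch condition if some tail of it does so in a subtree. -/
def ProofSystem.IsTailClosed (L : ProofSystem) : Prop :=
  ∀ (π π' : Preproof L.rules) (p p' : ℕ → List ℕ) (m : ℕ), (∀ w, π.node (p m ++ w) = π'.node w) →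
    (∀ j, p (m + j) = p m ++ p' j) → L.branchCondition π' p' → L.branchCondition π p

/-- A branch that leaves the states ends in a grafted proof and inherits its condition by tail
closure. Only the branches that stay among the states remain to be checked. -/
theorem ProofSystem.provable_graft {L : ProofSystem} (hL : L.IsTailClosed) {Q : Type}
    {label : Q → RuleInstance} {next : Q → ℕ → Option (Q ⊕ Preproof L.rules)}
    (hfit : GraftFits label next) (hmem : ∀ q, (label q).rule ∈ L.rules)
    (hproof : ∀ q n π, next q n = some (.inr π) → ∀ p, π.IsBranch p → L.branchCondition π p)
    (q : Q) (hstate : ∀ p, (Preproof.graft hfit hmem q).IsBranch p →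
      (∀ i, ∃ q', graftState next q (p i) = some q') →
        L.branchCondition (Preproof.graft hfit hmem q) p) :
    L.Provable (label q).concl.toSequent := by
  refine ⟨Preproof.graft hfit hmem q, ⟨_, rfl, rfl⟩, fun p hp => ?_⟩
  obtain h | ⟨m, q', n, π, p', h₁, h₂, h₃, h₄⟩ := Preproof.graft_branch hfit hmem hp
  · exact hstate p hp h
  · exact hL _ π p p' m h₄ h₃ (hproof q' n π h₁ p' h₂)

/-- A graft with a single state, whose successors are all proofs. No branch is at a state after its
first step, so no condition remains. -/
theorem ProofSystem.provable_of_premises {L : ProofSystem} (hL : L.IsTailClosed)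
    (s : RuleInstance) (hs : s.rule ∈ L.rules)
    (h : ∀ i P, s.prem i = some P → L.Provable P.toSequent) : L.Provable s.concl.toSequent := by
  have hex : ∀ i, ∃ ρ : Option (Preproof L.rules),
      ρ.map Preproof.concl = (s.prem i).map TracedSequent.toSequent ∧
        ∀ π, ρ = some π → ∀ p, π.IsBranch p → L.branchCondition π p := by
    intro i
    rcases hP : s.prem i with _ | P
    · exact ⟨none, by simp⟩
    · obtain ⟨π, hπ, hπ'⟩ := h i P hP
      refine ⟨some π, by simpa using (π.concludes_iff _).1 hπ, ?_⟩
      rintro _ ⟨⟩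
      exact hπ'
  choose ρ hρ hρ' using hex
  refine ProofSystem.provable_graft hL (label := fun _ : Unit => s)
    (next := fun _ i => (ρ i).map Sum.inr) (fun _ i => ?_) (fun _ => hs) ?_ () ?_
  · rw [← hρ, Option.map_map]
    rfl
  · intro _ n π hπ
    rw [Option.map_eq_some_iff] at hπ
    obtain ⟨_, hπ, ⟨⟩⟩ := hπ
    exact hρ' n _ hπ
  · intro p hp hstate
    obtain ⟨_, h₁⟩ := hstate 1
    obtain ⟨n, hn⟩ := hp.2.1 0
    rw [hn, hp.1, List.nil_append, graftState] at h₁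
    rcases hρn : ρ n with _ | π <;> rw [hρn] at h₁ <;> cases h₁

theorem omegaSystem_isTailClosed (R : Set AnalyticRule) : (omegaSystem R).IsTailClosed :=
  fun _ _ _ _ _ _ _ h => h

theorem Preproof.exists_isProgressing_of_tail {rules : Set Rule} {π π' : Preproof rules}
    {p p' : ℕ → List ℕ} {m : ℕ} (hnode : ∀ w, π.node (p m ++ w) = π'.node w)
    (hp : ∀ j, p (m + j) = p m ++ p' j) {I : Set ℕ} {t : ℕ → Occ} (ht : π'.IsProgressing p' I t) :
    ∃ I t, π.IsProgressing p I t := by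
  have hnode' : ∀ j, π.node (p (m + j)) = π'.node (p' j) := fun j => by rw [hp, hnode]
  have hfml : ∀ j o, π.formulaAt (p (m + j)) o = π'.formulaAt (p' j) o := by
    intro j o
    rw [Preproof.formulaAt, hnode', Preproof.formulaAt]
  -- The bound `m ≤ i` is needed because truncated subtraction sends every smaller index to `0`.
  let shift : Set ℕ → Set ℕ := fun J => {i | m ≤ i ∧ i - m ∈ J}
  have hmem : ∀ J : Set ℕ, ∀ i ∈ shift J, ∃ j ∈ J, i = m + j :=
    fun J i hi => ⟨i - m, hi.2, by have := hi.1; omega⟩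
  have hmem' : ∀ J : Set ℕ, ∀ j, m + j ∈ shift J ↔ j ∈ J := fun J j => by simp [shift]
  have hthread : ∀ J, π'.IsThread p' J t → π.IsThread p (shift J) (fun i => t (i - m)) := by
    rintro J ⟨⟨j, hj⟩, h₁, h₂, h₃⟩
    refine ⟨⟨m + j, (hmem' J j).2 hj⟩, ⟨?_⟩, ?_, ?_⟩
    · intro i hi k hk l hl
      exact ⟨hi.1.trans hl.1, h₁.out hi.2 hk.2 ⟨Nat.sub_le_sub_right hl.1 m,
        Nat.sub_le_sub_right hl.2 m⟩⟩
    · intro i hi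
      obtain ⟨j, hj, rfl⟩ := hmem J i hi
      rw [hfml]
      simpa using h₂ j hj
    · intro i hi hi'
      obtain ⟨j, hj, rfl⟩ := hmem J i hi
      rw [add_assoc, hmem'] at hi'
      obtain ⟨n, hn, s, P, hs, hsP⟩ := h₃ j hj hi'
      refine ⟨n, by rw [add_assoc, hp, hp, hn, List.append_assoc], s, P, by rw [hnode', hs], ?_⟩
      simpa [add_assoc] using hsP
  obtain ⟨hI, J, hJI, hfinal, ⟨hJ, α, hα⟩, hinf⟩ := ht
  refine ⟨shift I, fun i => t (i - m), hthread I hI, shift J, fun i hi => ⟨hi.1, hJI hi.2⟩, ?_,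
    ⟨hthread J hJ, α, ?_⟩, ?_⟩
  · intro i hi j hj hij
    exact ⟨hj.1, hfinal _ hi.2 _ hj.2 (Nat.sub_le_sub_right hij m)⟩
  · intro i hi
    obtain ⟨j, hj, rfl⟩ := hmem J i hi
    simpa [hfml] using hα j hj
  · refine (hinf.image (f := fun j => m + j) (add_right_injective m).injOn).mono ?_
    rintro _ ⟨j, ⟨hj, φ, hφ⟩, rfl⟩
    refine ⟨(hmem' J j).2 hj, φ, ?_⟩
    simpa [hfml] using hφ

theorem nonWellfoundedSystem_isTailClosed (R : Set AnalyticRule) :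
    (nonWellfoundedSystem R).IsTailClosed :=
  fun _ _ _ _ _ hnode hp ⟨_, _, ht⟩ => Preproof.exists_isProgressing_of_tail hnode hp ht

/-- The instantiation of `Γ`, `Δ`, `Σ`, `α`, `α₀`, `α₁` and `β`. -/
def instantiate (Γ Δ E : List Formula) (α α₀ α₁ β : Formula) : Instantiation where
  seq | 0 => Γ | 1 => Δ | _ => E
  fml | 0 => α | 1 => α₀ | 2 => α₁ | _ => β

/-- The formulas of an instantiated item. -/
def MItem.formulas (σ : Instantiation) : MItem → List Formula
  | .seq X => σ.seq X
  | .fml φ => [φ.fml.subst σ.fml]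

theorem MSequent.toSequent_inst (σ : Instantiation) (S : MSequent) :
    (S.inst σ).toSequent = ⟨S.ant.flatMap (MItem.formulas σ), S.succ.fml.subst σ.fml⟩ := by
  rw [TracedSequent.toSequent, MSequent.inst, List.map_flatMap]
  congr 1
  refine List.flatMap_congr fun m _ => ?_
  cases m
  · rw [MItem.inst, map_mapIdx]
    exact List.ext_getElem? (by simp [MItem.formulas])
  · simp [MItem.inst, MFormula.inst, MItem.formulas]

/-- The `ω`-rule is admissible in the non-wellfounded system. -/
theorem nonWellfoundedSystem_omega_rule {R : Set AnalyticRule} {Γ Δ : List Formula} {α β : Formula}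
    (h : ∀ n, (nonWellfoundedSystem R).Provable ⟨Γ ++ (List.replicate n α ++ Δ), β⟩) :
    (nonWellfoundedSystem R).Provable ⟨Γ ++ .star α :: Δ, β⟩ := by
  choose π hπ hπ' using h
  -- State `n` concludes `Γ, αⁿ, α∗, Δ ⇒ β`. Its left premise is the `n`-th given sequent, and its
  -- right premise is the conclusion of state `n + 1`.
  let label : ℕ → RuleInstance := fun n =>
    .schema Schema.starL (instantiate (Γ ++ List.replicate n α) Δ [] α α α β)
  let next : ℕ → ℕ → Option (ℕ ⊕ Preproof (nonWellfoundedSystem R).rules) := fun n i =>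
    match i with
    | 0 => some (.inr (π n))
    | 1 => some (.inl (n + 1))
    | _ => none
  have hfit : GraftFits label next := by
    rintro n (_ | _ | i)
    · simp [next, label, RuleInstance.prem, Schema.starL, Schema.ofList,
        (Preproof.concludes_iff _ _).1 (hπ n),
        MSequent.toSequent_inst, MItem.formulas, Schema.sq, Schema.G, Schema.D, instantiate,
        Formula.subst, Schema.b]
    · simp [next, label, RuleInstance.prem, RuleInstance.concl, Schema.starL,
        Schema.ofList, Schema.bx, Schema.a,
        MSequent.toSequent_inst, MItem.formulas, Schema.sq, Schema.G, Schema.D, instantiate,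
        Formula.subst, Schema.b, List.replicate_succ']
    · simp [next, label, RuleInstance.prem, Schema.starL, Schema.ofList]
  have hmem : ∀ n, (label n).rule ∈ (nonWellfoundedSystem R).rules := fun n => by
    simp [label, nonWellfoundedSystem, rulesWith, RuleInstance.rule]
  have hroot : (label 0).concl.toSequent = ⟨Γ ++ .star α :: Δ, β⟩ := by
    simp [label, RuleInstance.concl, Schema.starL, Schema.ofList, Schema.bx, Schema.a,
      MSequent.toSequent_inst, MItem.formulas, Schema.sq,
      Schema.G, Schema.D, instantiate, Formula.subst, Schema.b]
  rw [← hroot]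
  refine ProofSystem.provable_graft (nonWellfoundedSystem_isTailClosed R) hfit hmem ?_ 0 ?_
  · rintro n (_ | _ | i) _ ⟨⟩
    exact hπ' n
  intro p hp hstate
  -- The only branch that stays among the states takes the right premise forever.
  have hsucc : ∀ i, graftState next 0 (p i) = some i →
      p (i + 1) = p i ++ [1] ∧ graftState next 0 (p (i + 1)) = some (i + 1) := by
    intro i hi
    obtain ⟨n, hn⟩ := hp.2.1 i
    obtain ⟨q, hq⟩ := hstate (i + 1)
    rw [hn, graftState_append hi] at hq ⊢
    rcases n with _ | _ | n
    · cases hq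
    · exact ⟨rfl, rfl⟩
    · cases hq
  have hstate' : ∀ i, graftState next 0 (p i) = some i := by
    intro i
    induction i with
    | zero => rw [hp.1]; rfl
    | succ i ih => exact (hsucc i ih).2
  have hnode : ∀ i, (Preproof.graft hfit hmem 0).node (p i) = some (label i) := by
    intro i
    rw [← List.append_nil (p i)]
    exact graftNode_append (hstate' i) []
  -- The star of state `i` stands after `Γ` and `i` copies of `α`. It is principal at every node of
  -- the spine, so it yields a progressing thread.
  have hlabel : ∀ i, (label i).concl.formulaAt (some (Γ.length + i)) = some (.star α, .box) := by
    intro i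
    simp [label, RuleInstance.concl, Schema.starL, Schema.ofList, Schema.bx, Schema.a, Schema.sq,
      Schema.G, Schema.D, instantiate, MSequent.inst, MItem.inst, MFormula.inst, MFormula.origin,
      TracedSequent.formulaAt, Formula.subst]
  have hfml : ∀ i, (Preproof.graft hfit hmem 0).formulaAt (p i) (some (Γ.length + i)) =
      some (.star α, .box) := by
    intro i
    rw [Preproof.formulaAt, hnode, Option.bind_some, hlabel]
  have hthread : (Preproof.graft hfit hmem 0).IsThread p Set.univ
      fun i => some (Γ.length + i) := by
    refine ⟨Set.univ_nonempty, Set.ordConnected_univ, fun i _ => by simp [hfml], fun i _ _ => ?_⟩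
    refine ⟨1, (hsucc i (hstate' i)).1, label i, _, hnode i, rfl, .star α, .star α, .box,
      by simp, hlabel i, ?_⟩
    simp [Schema.bx, Schema.a, Schema.sq, Schema.G, Schema.D, instantiate, MSequent.inst,
      MItem.inst, MFormula.inst, MFormula.origin, TracedSequent.formulaAt, Formula.subst]
    rw [List.getElem?_append_right (by simp [← add_assoc]), List.length_mapIdx, List.length_append,
      List.length_replicate, ← add_assoc, Nat.add_sub_cancel_left]
    rfl
  refine ⟨Set.univ, _, hthread, Set.univ, subset_rfl, fun _ _ _ _ _ => trivial,
    ⟨hthread, α, fun i _ => ⟨by simp, _, hfml i⟩⟩, ?_⟩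
  convert Set.infinite_univ (α := ℕ)
  simp only [Set.mem_univ, true_and, iff_true, Set.ext_iff, Set.mem_ofPred_eq]
  exact fun i => ⟨_, hfml i⟩

/-! ### Completeness -/

/-- `P` is closed under the identity axiom, the principal rules including the `ω`-rule, and the
analytic rules in `R`. -/
structure IsRuleClosed (R : Set AnalyticRule) (P : Sequent → Prop) : Prop where
  ident (x : ℕ) : P ⟨[.var x], .var x⟩
  zeroL (Γ Δ β) : P ⟨Γ ++ .zero :: Δ, β⟩
  oneL (Γ Δ β) : P ⟨Γ ++ Δ, β⟩ → P ⟨Γ ++ .one :: Δ, β⟩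
  oneR : P ⟨[], .one⟩
  infL₀ (Γ Δ α₀ α₁ β) : P ⟨Γ ++ α₀ :: Δ, β⟩ → P ⟨Γ ++ .inf α₀ α₁ :: Δ, β⟩
  infL₁ (Γ Δ α₀ α₁ β) : P ⟨Γ ++ α₁ :: Δ, β⟩ → P ⟨Γ ++ .inf α₀ α₁ :: Δ, β⟩
  infR (Γ α₀ α₁) : P ⟨Γ, α₀⟩ → P ⟨Γ, α₁⟩ → P ⟨Γ, .inf α₀ α₁⟩
  supL (Γ Δ α₀ α₁ β) : P ⟨Γ ++ α₀ :: Δ, β⟩ → P ⟨Γ ++ α₁ :: Δ, β⟩ → P ⟨Γ ++ .sup α₀ α₁ :: Δ, β⟩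
  supR₀ (Γ α₀ α₁) : P ⟨Γ, α₀⟩ → P ⟨Γ, .sup α₀ α₁⟩
  supR₁ (Γ α₀ α₁) : P ⟨Γ, α₁⟩ → P ⟨Γ, .sup α₀ α₁⟩
  mulL (Γ Δ α₀ α₁ β) : P ⟨Γ ++ α₀ :: α₁ :: Δ, β⟩ → P ⟨Γ ++ .mul α₀ α₁ :: Δ, β⟩
  mulR (Γ Δ α₀ α₁) : P ⟨Γ, α₀⟩ → P ⟨Δ, α₁⟩ → P ⟨Γ ++ Δ, .mul α₀ α₁⟩
  lresL (Γ Δ E α₀ α₁ β) : P ⟨Δ, α₀⟩ → P ⟨Γ ++ α₁ :: E, β⟩ → P ⟨Γ ++ (Δ ++ .lres α₀ α₁ :: E), β⟩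
  rresL (Γ Δ E α₀ α₁ β) : P ⟨Δ, α₀⟩ → P ⟨Γ ++ α₁ :: E, β⟩ → P ⟨Γ ++ .rres α₁ α₀ :: (Δ ++ E), β⟩
  lresR (Γ α₀ α₁) : P ⟨α₀ :: Γ, α₁⟩ → P ⟨Γ, .lres α₀ α₁⟩
  rresR (Γ α₀ α₁) : P ⟨Γ ++ [α₀], α₁⟩ → P ⟨Γ, .rres α₁ α₀⟩
  starR₀ (α) : P ⟨[], .star α⟩
  starR₁ (Γ Δ α) : P ⟨Γ, α⟩ → P ⟨Δ, .star α⟩ → P ⟨Γ ++ Δ, .star α⟩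
  starL (Γ Δ α β) : (∀ n, P ⟨Γ ++ (List.replicate n α ++ Δ), β⟩) → P ⟨Γ ++ .star α :: Δ, β⟩
  analytic (r) (_ : r ∈ R) (x : ℕ → List Formula) (Γ Δ β) :
    (∀ l ∈ r.prems, P ⟨Γ ++ (l.flatMap x ++ Δ), β⟩) → P ⟨Γ ++ (r.Υ.flatMap x ++ Δ), β⟩

section

attribute [local simp] Schema.sq Schema.sqb Schema.bx Schema.G Schema.D Schema.E Schema.a Schema.a₀
  Schema.a₁ Schema.b Formula.subst instantiate MItem.formulas

/-- The `ω`-rule is a hypothesis because only the left star rule distinguishes the systems: it is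
primitive in one and admissible in the other. -/
theorem ProofSystem.isRuleClosed {L : ProofSystem} (hL : L.IsTailClosed) {R : Set AnalyticRule}
    {starLeft : Schema} (hrules : L.rules = rulesWith starLeft R)
    (hstar : ∀ Γ Δ α β, (∀ n, L.Provable ⟨Γ ++ (List.replicate n α ++ Δ), β⟩) →
      L.Provable ⟨Γ ++ .star α :: Δ, β⟩) : IsRuleClosed R L.Provable := by
  have key : ∀ (ps : List MSequent) (c : MSequent) (σ : Instantiation),
      Schema.ofList ps c ∈ Schema.common ∪ {starLeft} ∪ AnalyticRule.toSchema '' R →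
      (∀ p ∈ ps, L.Provable (p.inst σ).toSequent) → L.Provable (c.inst σ).toSequent := by
    intro ps c σ hr h
    refine ProofSystem.provable_of_premises hL (.schema (.ofList ps c) σ) ?_ ?_
    · rw [hrules]
      exact Or.inr ⟨_, hr, rfl⟩
    · intro i P hP
      simp only [RuleInstance.prem, Option.map_eq_some_iff, Schema.ofList] at hP
      obtain ⟨p, hp, rfl⟩ := hP
      exact h p (List.mem_of_getElem? hp)
  have key' : ∀ (ps : List MSequent) (c : MSequent) (σ : Instantiation),
      Schema.ofList ps c ∈ Schema.common →
      (∀ p ∈ ps, L.Provable (p.inst σ).toSequent) → L.Provable (c.inst σ).toSequent :=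
    fun ps c σ h => key ps c σ (Or.inl (Or.inl h))
  simp only [MSequent.toSequent_inst] at key key'
  constructor
  case ident =>
    refine fun x => ProofSystem.provable_of_premises hL (.ident x) ?_ ?_
    · rw [hrules]
      exact Or.inl rfl
    · rintro i P ⟨⟩
  case starL => exact hstar
  case analytic =>
    intro r hr x Γ Δ β h
    classical
    have hnodup := r.nodup
    simp only [List.nodup_cons, List.mem_cons, not_or] at hnodup
    -- The contexts override `x` at their own metavariables. These do not occur in `Υ`, hence not in
    -- the premises, so the members of `Υ` keep their values.
    let σ : Instantiation :=
      ⟨Function.update (Function.update x r.Γ Γ) r.Δ Δ, fun _ => β⟩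
    have hσ : ∀ l : List ℕ, (∀ X ∈ l, X ∈ r.Υ) →
        (((r.sequent l).inst σ).toSequent : Sequent) = ⟨Γ ++ (l.flatMap x ++ Δ), β⟩ := by
      intro l hl
      simp only [MSequent.toSequent_inst, AnalyticRule.sequent, Formula.subst, σ, MItem.formulas,
        List.flatMap_cons, List.flatMap_append, List.flatMap_map, List.flatMap_nil,
        Function.update_self, List.append_nil, Function.update_of_ne hnodup.1.1]
      congr 3
      refine List.flatMap_congr fun X hX => ?_
      rw [Function.update_of_ne, Function.update_of_ne]
      · rintro rfl
        exact hnodup.1.2 (hl _ hX)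
      · rintro rfl
        exact hnodup.2.1 (hl _ hX)
    rw [← hσ _ fun _ => id, MSequent.toSequent_inst]
    refine key (r.prems.map r.sequent) _ σ (Or.inr ⟨r, hr, rfl⟩) ?_
    simp only [List.mem_map, forall_exists_index, and_imp, forall_apply_eq_imp_iff₂,
      ← MSequent.toSequent_inst]
    intro l hl
    rw [hσ l (r.prems_sub l hl)]
    exact h l hl
  case zeroL =>
    intro Γ Δ β
    -- Here and below, metavariables that are absent from the rule receive dummy values.
    simpa using key' _ _ (instantiate Γ Δ [] β β β β)
      (show Schema.zeroL ∈ Schema.common by simp [Schema.common])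
  case oneL =>
    intro Γ Δ β h
    simpa [h] using key' _ _ (instantiate Γ Δ [] β β β β)
      (show Schema.oneL ∈ Schema.common by simp [Schema.common])
  case oneR =>
    simpa using key' _ _ (instantiate [] [] [] .one .one .one .one)
      (show Schema.oneR ∈ Schema.common by simp [Schema.common])
  case infL₀ =>
    intro Γ Δ α₀ α₁ β h
    simpa [h] using key' _ _ (instantiate Γ Δ [] α₀ α₀ α₁ β)
      (show Schema.infL₀ ∈ Schema.common by simp [Schema.common])
  case infL₁ =>
    intro Γ Δ α₀ α₁ β h
    simpa [h] using key' _ _ (instantiate Γ Δ [] α₀ α₀ α₁ β)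
      (show Schema.infL₁ ∈ Schema.common by simp [Schema.common])
  case infR =>
    intro Γ α₀ α₁ h h'
    simpa [h, h'] using key' _ _ (instantiate Γ [] [] α₀ α₀ α₁ α₀)
      (show Schema.infR ∈ Schema.common by simp [Schema.common])
  case supL =>
    intro Γ Δ α₀ α₁ β h h'
    simpa [h, h'] using key' _ _ (instantiate Γ Δ [] α₀ α₀ α₁ β)
      (show Schema.supL ∈ Schema.common by simp [Schema.common])
  case supR₀ =>
    intro Γ α₀ α₁ h
    simpa [h] using key' _ _ (instantiate Γ [] [] α₀ α₀ α₁ α₀)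
      (show Schema.supR₀ ∈ Schema.common by simp [Schema.common])
  case supR₁ =>
    intro Γ α₀ α₁ h
    simpa [h] using key' _ _ (instantiate Γ [] [] α₀ α₀ α₁ α₀)
      (show Schema.supR₁ ∈ Schema.common by simp [Schema.common])
  case mulL =>
    intro Γ Δ α₀ α₁ β h
    simpa [h] using key' _ _ (instantiate Γ Δ [] α₀ α₀ α₁ β)
      (show Schema.mulL ∈ Schema.common by simp [Schema.common])
  case mulR =>
    intro Γ Δ α₀ α₁ h h'
    simpa [h, h'] using key' _ _ (instantiate Γ Δ [] α₀ α₀ α₁ α₀)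
      (show Schema.mulR ∈ Schema.common by simp [Schema.common])
  case lresL =>
    intro Γ Δ E α₀ α₁ β h h'
    simpa [h, h'] using key' _ _ (instantiate Γ Δ E α₀ α₀ α₁ β)
      (show Schema.lresL ∈ Schema.common by simp [Schema.common])
  case rresL =>
    intro Γ Δ E α₀ α₁ β h h'
    simpa [h, h'] using key' _ _ (instantiate Γ Δ E α₀ α₀ α₁ β)
      (show Schema.rresL ∈ Schema.common by simp [Schema.common])
  case lresR =>
    intro Γ α₀ α₁ h
    simpa [h] using key' _ _ (instantiate Γ [] [] α₀ α₀ α₁ α₀)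
      (show Schema.lresR ∈ Schema.common by simp [Schema.common])
  case rresR =>
    intro Γ α₀ α₁ h
    simpa [h] using key' _ _ (instantiate Γ [] [] α₀ α₀ α₁ α₀)
      (show Schema.rresR ∈ Schema.common by simp [Schema.common])
  case starR₀ =>
    intro α
    simpa using key' _ _ (instantiate [] [] [] α α α α)
      (show Schema.starR₀ ∈ Schema.common by simp [Schema.common])
  case starR₁ =>
    intro Γ Δ α h h'
    simpa [h, h'] using key' _ _ (instantiate Γ Δ [] α α α α)
      (show Schema.starR₁ ∈ Schema.common by simp [Schema.common])

end

theorem omegaSystem_isRuleClosed (R : Set AnalyticRule) :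
    IsRuleClosed R (omegaSystem R).Provable := by
  refine ProofSystem.isRuleClosed (omegaSystem_isTailClosed R) (starLeft := Schema.starLω) rfl ?_
  intro Γ Δ α β h
  have := ProofSystem.provable_of_premises (omegaSystem_isTailClosed R)
    (.schema Schema.starLω (instantiate Γ Δ [] α α α β))
    (by simp [omegaSystem, rulesWith, RuleInstance.rule])
  simp only [RuleInstance.prem, RuleInstance.concl, Schema.starLω, Option.map_some,
    Option.some.injEq, forall_eq', MSequent.toSequent_inst] at this
  simpa [Schema.sq, Schema.bx, Schema.G, Schema.D, Schema.a, Schema.b, Formula.subst, instantiate,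
    MItem.formulas, List.flatMap_replicate, h] using this

theorem nonWellfoundedSystem_isRuleClosed (R : Set AnalyticRule) :
    IsRuleClosed R (nonWellfoundedSystem R).Provable :=
  ProofSystem.isRuleClosed (nonWellfoundedSystem_isTailClosed R) rfl
    fun _ _ _ _ => nonWellfoundedSystem_omega_rule

/-! ### The algebra of closed sets -/

/-- The closure of a set of sequences of formulas: all sequences that are derivable in every context
in which all the members of the set are derivable. -/
def closure (P : Sequent → Prop) (X : Set (List Formula)) : Set (List Formula) :=
  {Γ | ∀ Δ₁ Δ₂ β, (∀ Γ' ∈ X, P ⟨Δ₁ ++ (Γ' ++ Δ₂), β⟩) → P ⟨Δ₁ ++ (Γ ++ Δ₂), β⟩}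

/-- The closed sets of sequences of formulas. -/
@[ext]
structure ClosedSet (P : Sequent → Prop) : Type u where
  carrier : Set (List Formula)
  closure_subset : closure P carrier ⊆ carrier

namespace ClosedSet

variable {P : Sequent → Prop}

instance : PartialOrder (ClosedSet.{u} P) :=
  PartialOrder.lift carrier fun _ _ => ClosedSet.ext

/-- The closed set generated by a set. -/
def generate (X : Set (List Formula)) : ClosedSet.{u} P where
  carrier := closure P X
  closure_subset _ h Δ₁ Δ₂ β hX := h Δ₁ Δ₂ β fun _ h' => h' Δ₁ Δ₂ β hX

theorem subset_generate (X : Set (List Formula)) :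
    X ⊆ (generate X : ClosedSet.{u} P).carrier :=
  fun Γ hΓ _ _ _ h => h Γ hΓ

theorem generate_le_iff {X : Set (List Formula)} {Y : ClosedSet.{u} P} :
    generate X ≤ Y ↔ X ⊆ Y.carrier :=
  ⟨fun h => (subset_generate X).trans h, fun h _ hΓ => Y.closure_subset
    fun Δ₁ Δ₂ β hY => hΓ Δ₁ Δ₂ β fun Γ' hΓ' => hY Γ' (h hΓ')⟩

/-- The sequences that are derivable in a given context. -/
def basic (Δ₁ Δ₂ : List Formula) (β : Formula) : ClosedSet.{u} P where
  carrier := {Γ | P ⟨Δ₁ ++ (Γ ++ Δ₂), β⟩}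
  closure_subset _ h := h Δ₁ Δ₂ β fun _ => id

theorem le_iff {X Y : ClosedSet.{u} P} : X ≤ Y ↔ X.carrier ⊆ Y.carrier := Iff.rfl

instance : Lattice (ClosedSet.{u} P) where
  inf X Y := ⟨X.carrier ∩ Y.carrier, fun _ h =>
    ⟨X.closure_subset fun Δ₁ Δ₂ β h' => h Δ₁ Δ₂ β fun Γ' hΓ' => h' Γ' hΓ'.1,
      Y.closure_subset fun Δ₁ Δ₂ β h' => h Δ₁ Δ₂ β fun Γ' hΓ' => h' Γ' hΓ'.2⟩⟩
  inf_le_left _ _ := Set.inter_subset_left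
  inf_le_right _ _ := Set.inter_subset_right
  le_inf _ _ _ := Set.subset_inter
  sup X Y := generate (X.carrier ∪ Y.carrier)
  le_sup_left _ _ := Set.subset_union_left.trans (subset_generate _)
  le_sup_right _ _ := Set.subset_union_right.trans (subset_generate _)
  sup_le _ _ _ h₁ h₂ := generate_le_iff.2 (Set.union_subset h₁ h₂)

instance : OrderBot (ClosedSet.{u} P) where
  bot := generate ∅
  bot_le _ := generate_le_iff.2 (Set.empty_subset _)

instance : One (ClosedSet.{u} P) := ⟨generate {[]}⟩

instance : Mul (ClosedSet.{u} P) := ⟨fun X Y => generate (Set.image2 (· ++ ·) X.carrier Y.carrier)⟩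

theorem one_le_iff {X : ClosedSet.{u} P} : 1 ≤ X ↔ [] ∈ X.carrier :=
  generate_le_iff.trans Set.singleton_subset_iff

theorem mul_le_iff {X Y Z : ClosedSet.{u} P} :
    X * Y ≤ Z ↔ ∀ Γ ∈ X.carrier, ∀ Δ ∈ Y.carrier, Γ ++ Δ ∈ Z.carrier :=
  generate_le_iff.trans Set.image2_subset_iff

theorem append_mem_mul {X Y : ClosedSet.{u} P} {Γ Δ : List Formula} (hΓ : Γ ∈ X.carrier)
    (hΔ : Δ ∈ Y.carrier) : Γ ++ Δ ∈ (X * Y).carrier :=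
  mul_le_iff.1 le_rfl Γ hΓ Δ hΔ

theorem nil_mem_one : [] ∈ (1 : ClosedSet.{u} P).carrier :=
  one_le_iff.1 le_rfl

/-- The left residual. -/
def leftResidual (X Z : ClosedSet.{u} P) : ClosedSet.{u} P where
  carrier := {Δ | ∀ Γ ∈ X.carrier, Γ ++ Δ ∈ Z.carrier}
  closure_subset _ h Γ hΓ := Z.closure_subset fun Δ₁ Δ₂ β hZ => by
    simpa using h (Δ₁ ++ Γ) Δ₂ β fun Δ' hΔ' => by simpa using hZ _ (hΔ' Γ hΓ)

/-- The right residual. -/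
def rightResidual (Z Y : ClosedSet.{u} P) : ClosedSet.{u} P where
  carrier := {Γ | ∀ Δ ∈ Y.carrier, Γ ++ Δ ∈ Z.carrier}
  closure_subset _ h Δ hΔ := Z.closure_subset fun Δ₁ Δ₂ β hZ => by
    simpa using h Δ₁ (Δ ++ Δ₂) β fun Γ' hΓ' => by simpa using hZ _ (hΓ' Δ hΔ)

theorem mul_le_iff_le_leftResidual (X Y Z : ClosedSet.{u} P) :
    X * Y ≤ Z ↔ Y ≤ leftResidual X Z :=
  mul_le_iff.trans ⟨fun h Δ hΔ Γ hΓ => h Γ hΓ Δ hΔ, fun h Γ hΓ _ hΔ => h hΔ Γ hΓ⟩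

theorem mul_le_iff_le_rightResidual (X Y Z : ClosedSet.{u} P) :
    X * Y ≤ Z ↔ X ≤ rightResidual Z Y :=
  mul_le_iff

/-- Products are closures, so the two sides are compared through their upper bounds: residuation and
`mul_le_iff` eliminate the closures and leave the monoid laws of concatenation. -/
instance : Monoid (ClosedSet.{u} P) where
  mul_assoc X Y Z := eq_of_forall_ge_iff fun W => by
    rw [mul_le_iff_le_rightResidual, mul_le_iff, mul_le_iff_le_leftResidual, mul_le_iff]
    simp only [leftResidual, rightResidual, Set.mem_ofPred_eq, List.append_assoc]
    exact ⟨fun h Γ hΓ Δ hΔ E hE => h E hE Γ hΓ Δ hΔ, fun h E hE Γ hΓ Δ hΔ => h Γ hΓ Δ hΔ E hE⟩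
  one_mul X := eq_of_forall_ge_iff fun W => by
    rw [mul_le_iff_le_rightResidual, one_le_iff]
    exact Iff.rfl
  mul_one X := eq_of_forall_ge_iff fun W => by
    rw [mul_le_iff_le_leftResidual, one_le_iff]
    simp only [leftResidual, Set.mem_ofPred_eq, List.append_nil]
    exact Iff.rfl

instance : ResiduatedLattice (ClosedSet.{u} P) where
  lres := leftResidual
  rres := rightResidual
  mul_le_iff_le_lres := mul_le_iff_le_leftResidual
  mul_le_iff_le_rres := mul_le_iff_le_rightResidual

/-- This choice builds in `*`-continuity; the induction laws for star then reduce to inductions on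
powers. -/
instance : KStar (ClosedSet.{u} P) := ⟨fun X => generate (⋃ n : ℕ, (X ^ n).carrier)⟩

theorem star_le_iff {X Y : ClosedSet.{u} P} : X∗ ≤ Y ↔ ∀ n : ℕ, X ^ n ≤ Y :=
  generate_le_iff.trans Set.iUnion_subset_iff

theorem pow_le_star (X : ClosedSet.{u} P) (n : ℕ) : X ^ n ≤ X∗ :=
  star_le_iff.1 le_rfl n

instance : ActionLattice (ClosedSet.{u} P) where
  one_sup_mul_star_le X := by
    refine sup_le ((pow_zero X).symm.trans_le (pow_le_star X 0)) ?_
    rw [mul_le_iff_le_lres, star_le_iff]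
    intro n
    rw [← mul_le_iff_le_lres, ← pow_succ']
    exact pow_le_star X _
  star_mul_le X Y h := by
    rw [mul_le_iff_le_rres, star_le_iff]
    intro n
    rw [← mul_le_iff_le_rres]
    induction n with
    | zero => rw [pow_zero, one_mul]
    | succ n ih =>
      rw [pow_succ, mul_assoc]
      exact (mul_le_mul_right h _).trans ih
  mul_star_le X Y h := by
    rw [mul_le_iff_le_lres, star_le_iff]
    intro n
    rw [← mul_le_iff_le_lres]
    induction n with
    | zero => rw [pow_zero, mul_one]
    | succ n ih =>
      rw [pow_succ', ← mul_assoc]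
      exact (mul_le_mul_left h _).trans ih

theorem isStarContinuous : IsStarContinuous (ClosedSet.{u} P) := fun X =>
  ⟨Set.forall_mem_range.2 (pow_le_star X), fun _ h => star_le_iff.2 (Set.forall_mem_range.1 h)⟩

theorem flatMap_mem_prod {V : ℕ → ClosedSet.{u} P} {x : ℕ → List Formula} :
    ∀ l : List ℕ, (∀ X ∈ l, x X ∈ (V X).carrier) → l.flatMap x ∈ ((l.map V).prod).carrier
  | [], _ => nil_mem_one
  | X :: l, h => by
    rw [List.map_cons, List.prod_cons, List.flatMap_cons]
    exact append_mem_mul (h X List.mem_cons_self)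
      (flatMap_mem_prod l fun Y hY => h Y (List.mem_cons_of_mem _ hY))

/-- Distinctness of the variables is essential: one assignment `x` then realises every independent
choice of a factor from each `V X`. The converse membership `flatMap_mem_prod` tolerates
repetitions, as the premises of analytic rules require. -/
theorem prod_le_of_forall {V : ℕ → ClosedSet.{u} P} :
    ∀ (l : List ℕ) (Y : ClosedSet.{u} P), l.Nodup →
      (∀ x : ℕ → List Formula, (∀ X ∈ l, x X ∈ (V X).carrier) → l.flatMap x ∈ Y.carrier) →
        (l.map V).prod ≤ Y
  | [], Y, _, h => one_le_iff.2 (h (fun _ => []) (by simp))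
  | X :: l, Y, hl, h => by
    rw [List.map_cons, List.prod_cons, mul_le_iff_le_leftResidual]
    rw [List.nodup_cons] at hl
    refine prod_le_of_forall l _ hl.2 fun x hx Γ hΓ => ?_
    have hne : ∀ Z ∈ l, Function.update x X Γ Z = x Z := fun Z hZ =>
      Function.update_of_ne (ne_of_mem_of_not_mem hZ hl.1) _ _
    have := h (Function.update x X Γ) fun Z hZ => by
      rcases List.mem_cons.1 hZ with rfl | hZ
      · rwa [Function.update_self]
      · rw [hne Z hZ]
        exact hx Z hZ
    rwa [List.flatMap_cons, Function.update_self, List.flatMap_congr hne] at this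

theorem quasiequation_holds {R : Set AnalyticRule} (hP : IsRuleClosed R P) {r : AnalyticRule}
    (hr : r ∈ R) : r.quasiequation.Holds (ClosedSet.{u} P) := by
  intro v
  simp only [AnalyticRule.quasiequation, AnalyticRule.term, Inequation.HoldsAt, Formula.eval_prod,
    List.mem_map, forall_exists_index, and_imp, forall_apply_eq_imp_iff₂, List.map_map,
    Formula.eval, Function.comp_def]
  intro h
  have hnodup := r.nodup
  simp only [List.nodup_cons] at hnodup
  refine prod_le_of_forall (V := fun X => v (AnalyticRule.toVar (.inl X))) _ _ hnodup.2.2 ?_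
  intro x hx
  refine (v _).closure_subset fun Δ₁ Δ₂ β hβ => hP.analytic r hr x Δ₁ Δ₂ β fun l hl => hβ _ ?_
  exact h l hl (flatMap_mem_prod (V := fun X => v (AnalyticRule.toVar (.inl X))) l
    fun X hX => hx X (r.prems_sub l hl X hX))

end ClosedSet

/-! ### The canonical valuation and completeness -/

/-- The canonical valuation. -/
def canonicalValuation (P : Sequent → Prop) (x : ℕ) : ClosedSet.{u} P :=
  ClosedSet.generate {[.var x]}

theorem ClosedSet.replicate_mem_pow {P : Sequent → Prop} {X : ClosedSet.{u} P} {α : Formula}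
    (h : [α] ∈ X.carrier) (n : ℕ) : List.replicate n α ∈ (X ^ n).carrier := by
  induction n with
  | zero =>
    rw [pow_zero]
    exact nil_mem_one
  | succ n ih =>
    rw [pow_succ']
    exact append_mem_mul h ih

/-- The value of a formula under the canonical valuation contains the formula, and each of its
members derives the formula. -/
theorem canonical_eval {R : Set AnalyticRule} {P : Sequent → Prop} (hP : IsRuleClosed R P)
    (φ : Formula) : [φ] ∈ (φ.eval (canonicalValuation.{u} P)).carrier ∧
      ∀ Γ ∈ (φ.eval (canonicalValuation.{u} P)).carrier, P ⟨Γ, φ⟩ := by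
  have key : ∀ (Y : ClosedSet.{u} P) (φ : Formula), Y ≤ ClosedSet.basic [] [] φ ↔
      ∀ Γ ∈ Y.carrier, P ⟨Γ, φ⟩ := fun Y φ => by
    simp [ClosedSet.le_iff, ClosedSet.basic, Set.subset_def]
  -- In this form the second half is an inequality into a closed set, so it can be checked on
  -- generators.
  rw [← key]
  induction φ with
  | var x =>
    refine ⟨ClosedSet.subset_generate _ rfl, ClosedSet.generate_le_iff.2 ?_⟩
    simpa [ClosedSet.basic] using hP.ident x
  | zero => exact ⟨fun Δ₁ Δ₂ β _ => hP.zeroL Δ₁ Δ₂ β, bot_le⟩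
  | one =>
    refine ⟨fun Δ₁ Δ₂ β h => hP.oneL Δ₁ Δ₂ β (h [] rfl), ClosedSet.one_le_iff.2 ?_⟩
    simpa [ClosedSet.basic] using hP.oneR
  | inf φ ψ ihφ ihψ =>
    refine ⟨⟨?_, ?_⟩, ?_⟩
    · exact ClosedSet.closure_subset _ fun Δ₁ Δ₂ β h => hP.infL₀ _ _ _ _ _ (h _ ihφ.1)
    · exact ClosedSet.closure_subset _ fun Δ₁ Δ₂ β h => hP.infL₁ _ _ _ _ _ (h _ ihψ.1)
    · rw [key] at ihφ ihψ ⊢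
      exact fun Γ hΓ => hP.infR _ _ _ (ihφ.2 _ hΓ.1) (ihψ.2 _ hΓ.2)
  | sup φ ψ ihφ ihψ =>
    refine ⟨fun Δ₁ Δ₂ β h => hP.supL _ _ _ _ _ (h _ (Or.inl ihφ.1)) (h _ (Or.inr ihψ.1)),
      sup_le ?_ ?_⟩
    · rw [key] at ihφ ⊢
      exact fun Γ hΓ => hP.supR₀ _ _ _ (ihφ.2 _ hΓ)
    · rw [key] at ihψ ⊢
      exact fun Γ hΓ => hP.supR₁ _ _ _ (ihψ.2 _ hΓ)
  | mul φ ψ ihφ ihψ =>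
    refine ⟨fun Δ₁ Δ₂ β h => hP.mulL _ _ _ _ _ (h _ ⟨_, ihφ.1, _, ihψ.1, rfl⟩),
      ClosedSet.mul_le_iff.2 fun Γ hΓ Δ hΔ => ?_⟩
    rw [key] at ihφ ihψ
    simpa [ClosedSet.basic] using hP.mulR _ _ _ _ (ihφ.2 _ hΓ) (ihψ.2 _ hΔ)
  | lres φ ψ ihφ ihψ =>
    rw [key] at ihφ ihψ ⊢
    refine ⟨fun Γ hΓ => ClosedSet.closure_subset _ fun Δ₁ Δ₂ β h => ?_, fun Γ hΓ => ?_⟩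
    -- The left rule combines the upper bound for `φ` with the membership of `[ψ]`; the right rule
    -- below uses the opposite halves. This interplay replaces cut.
    · simpa using hP.lresL _ _ _ _ _ _ (ihφ.2 Γ hΓ) (h _ ihψ.1)
    · exact hP.lresR _ _ _ (ihψ.2 _ (hΓ _ ihφ.1))
  | rres φ ψ ihφ ihψ =>
    rw [key] at ihφ ihψ ⊢
    refine ⟨fun Γ hΓ => ClosedSet.closure_subset _ fun Δ₁ Δ₂ β h => ?_, fun Γ hΓ => ?_⟩
    · simpa using hP.rresL _ _ _ _ _ _ (ihψ.2 Γ hΓ) (h _ ihφ.1)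
    · exact hP.rresR _ _ _ (ihφ.2 _ (hΓ _ ihψ.1))
  | star φ ih =>
    refine ⟨fun Δ₁ Δ₂ β h => hP.starL _ _ _ _ fun n => h _ ?_, ClosedSet.star_le_iff.2 fun n => ?_⟩
    -- The sequence of `n` copies of `φ` lies in the `n`-th power, which supplies the `n`-th premise
    -- of the `ω`-rule.
    · exact Set.mem_iUnion.2 ⟨n, ClosedSet.replicate_mem_pow ih.1 n⟩
    · rw [key] at ih
      induction n with
      | zero =>
        rw [pow_zero, ClosedSet.one_le_iff]
        simpa [ClosedSet.basic] using hP.starR₀ φ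
      | succ n ihn =>
        rw [pow_succ', ClosedSet.mul_le_iff]
        intro Γ hΓ Δ hΔ
        rw [key] at ihn
        simpa [ClosedSet.basic] using hP.starR₁ _ _ _ (ih.2 _ hΓ) (ihn _ hΔ)

theorem IsRuleClosed.of_validIn {R : Set AnalyticRule} {P : Sequent → Prop}
    (hP : IsRuleClosed R P) {S : Sequent}
    (h : ValidIn.{u} (AnalyticRule.quasiequation '' R) S) : P S := by
  -- The algebra is declared in `Type u`, so validity in any fixed universe applies to it.
  have hS := h (ClosedSet.{u} P) ClosedSet.isStarContinuous
    (Set.forall_mem_image.2 fun r hr => ClosedSet.quasiequation_holds hP hr)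
    (canonicalValuation.{u} P)
  rw [Sequent.holdsAt_iff] at hS
  refine (canonical_eval hP S.succ).2 _ (hS ?_)
  have : ∀ l : List Formula,
      l ∈ ((l.map (Formula.eval (canonicalValuation.{u} P))).prod).carrier := by
    intro l
    induction l with
    | nil => exact ClosedSet.nil_mem_one
    | cons φ l ih =>
      rw [List.map_cons, List.prod_cons]
      exact ClosedSet.append_mem_mul (canonical_eval hP φ).1 ih
  exact this S.ant

end ActionLogic

theorem mainTheorem1 (R : Set ActionLogic.AnalyticRule) :
    (∀ S : ActionLogic.Sequent,
      (ActionLogic.omegaSystem R).Provable S ↔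
        ActionLogic.ValidIn.{u} (ActionLogic.AnalyticRule.quasiequation '' R) S) ∧
    (∀ S : ActionLogic.Sequent,
      (ActionLogic.nonWellfoundedSystem R).Provable S ↔
        ActionLogic.ValidIn.{u} (ActionLogic.AnalyticRule.quasiequation '' R) S) :=
  ⟨fun _ => ⟨ActionLogic.validIn_of_provable_omegaSystem,
      (ActionLogic.omegaSystem_isRuleClosed R).of_validIn⟩,
    fun _ => ⟨ActionLogic.validIn_of_provable_nonWellfoundedSystem,
      (ActionLogic.nonWellfoundedSystem_isRuleClosed R).of_validIn⟩⟩
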